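/- Let $M=\mathbb{P}(T\mathbb{P}^2)$ be the contact variety of the complex projective plane, identified with the incidence variety $\{(p,l)\in\mathbb{P}^2\times\check{\mathbb{P}}^2 : p\in l\}$, with projections $\pi:M\to\mathbb{P}^2$ and $\check\pi:M\to\check{\mathbb{P}}^2$. Let $\mathcal{D}\subset TM$ be the contact distribution, $\mathcal{D}_{(z,[v])}=(d\pi)^{-1}(\mathbb{C}v)$, and for integers $a,b$ let $\mathcal{O}_M(a,b)=\pi^*\mathcal{O}_{\mathbb{P}^2}(a)\otimes\check\pi^*\mathcal{O}_{\check{\mathbb{P}}^2}(b)$. Let $$\mathcal{E}(a,b)=\mathbb{P}\,H^0\bigl(M,\mathcal{D}\otimes\mathcal{O}_M(a,b)\bigr)$$ be the space of second order differential equations of bidegree $(a,b)$ on $\mathbb{P}^2$, where $H^0$ denotes the space of global holomorphic sections. Proposition. For all integers $a,b\ge 1$ the space $H^0(M,\mathcal{D}\otimes\mathcal{O}_M(a,b))$ is finite-dimensional and $$\dim\mathcal{E}(a,b)=\tfrac12\bigl(2a^2b+2ab^2+3a^2+3b^2+12ab+9a+9b\bigr)-1 .$$ -/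

import Mathlib

open scoped LinearAlgebra.Projectivization TensorProduct Matrix

noncomputable section

namespace SecondOrderODE

/-- The complex vector space `ℂ³`. The projective plane is `ℙ ℂ V`; the dual projective plane is
also written `ℙ ℂ V`, where the class of `ξ` is the line `{ξ₀ x₀ + ξ₁ x₁ + ξ₂ x₂ = 0}`. -/
abbrev V : Type := Fin 3 → ℂ

/-- The contact variety `M = ℙ(Tℙ²)`, as the incidence variety of points and lines: a pair
`(p, l)` with `p ∈ l` is the point `p` together with the tangent direction of `l` at `p`. -/
def M : Type :=
  {q : ℙ ℂ V × ℙ ℂ V // ∀ x ∈ q.1.submodule, ∀ ξ ∈ q.2.submodule, ξ ⬝ᵥ x = 0}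

/-- The line in `ℂ³` that is the point `π(m)` of the projective plane. -/
def pt (m : M) : Submodule ℂ V := m.1.1.submodule

/-- The line in the dual of `ℂ³` that is the point `π̌(m)` of the dual projective plane. -/
def ln (m : M) : Submodule ℂ V := m.1.2.submodule

/-- The tangent space `Hom(L, ℂ³/L)` of the projective plane at the point given by a line `L`. -/
abbrev TP (L : Submodule ℂ V) : Type := L →ₗ[ℂ] (V ⧸ L)

/-- The tangent space of `M` at `m`, inside that of `ℙ² × ℙ̌²`: the kernel of the differential
`ξ·ẋ + ξ̇·x` of the incidence equation `ξ·x = 0`. The choice of the lifts `ẋ`, `ξ̇` of the images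
of `x`, `ξ` is immaterial, because `ξ·x = 0`. -/
def TM (m : M) : Submodule ℂ (TP (pt m) × TP (ln m)) where
  carrier := {p | ∀ (x : pt m) (ξ : ln m) (u η : V),
    p.1 x = (pt m).mkQ u → p.2 ξ = (ln m).mkQ η → (ξ : V) ⬝ᵥ u + η ⬝ᵥ (x : V) = 0}
  zero_mem' := by
    intro x ξ u η hu hη
    have hu' : u ∈ pt m := (Submodule.Quotient.mk_eq_zero _).1 hu.symm
    have hη' : η ∈ ln m := (Submodule.Quotient.mk_eq_zero _).1 hη.symm
    rw [m.2 u hu' ξ ξ.2, m.2 x x.2 η hη', add_zero]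
  add_mem' := by
    intro p q hp hq x ξ u η hu hη
    obtain ⟨u₁, hu₁⟩ := (pt m).mkQ_surjective (p.1 x)
    obtain ⟨η₁, hη₁⟩ := (ln m).mkQ_surjective (p.2 ξ)
    have h₁ := hp x ξ u₁ η₁ hu₁.symm hη₁.symm
    have h₂ := hq x ξ (u - u₁) (η - η₁)
      (by rw [map_sub, hu₁, ← hu]; simp) (by rw [map_sub, hη₁, ← hη]; simp)
    rw [dotProduct_sub, sub_dotProduct] at h₂
    linear_combination h₁ + h₂
  smul_mem' := by
    intro k p hp x ξ u η hu hη
    obtain ⟨u₁, hu₁⟩ := (pt m).mkQ_surjective (p.1 x)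
    obtain ⟨η₁, hη₁⟩ := (ln m).mkQ_surjective (p.2 ξ)
    have h₁ := hp x ξ u₁ η₁ hu₁.symm hη₁.symm
    have hu' : u - k • u₁ ∈ pt m := by
      refine (Submodule.Quotient.mk_eq_zero _).1 ?_
      change (pt m).mkQ (u - k • u₁) = 0
      rw [map_sub, map_smul, hu₁, ← hu]; simp
    have hη' : η - k • η₁ ∈ ln m := by
      refine (Submodule.Quotient.mk_eq_zero _).1 ?_
      change (ln m).mkQ (η - k • η₁) = 0
      rw [map_sub, map_smul, hη₁, ← hη]; simp
    have h₂ := m.2 _ hu' ξ ξ.2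
    have h₃ := m.2 x x.2 _ hη'
    rw [dotProduct_sub, dotProduct_smul, smul_eq_mul] at h₂
    rw [sub_dotProduct, smul_dotProduct, smul_eq_mul] at h₃
    linear_combination k * h₁ + h₂ + h₃

/-- The differential at `m` of the projection `π : M → ℙ²`. -/
def dπ (m : M) : TM m →ₗ[ℂ] TP (pt m) := LinearMap.fst ℂ _ _ ∘ₗ (TM m).subtype

/-- For `m = (p, l)`, the subspace `ℓ ⊆ ℂ³` of dimension two whose projectivization is the
line `l`. -/
def plane (m : M) : Submodule ℂ V where
  carrier := {x | ∀ ξ ∈ ln m, ξ ⬝ᵥ x = 0}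
  zero_mem' := fun ξ _ => dotProduct_zero ξ
  add_mem' := fun hx hy ξ hξ => by rw [dotProduct_add, hx ξ hξ, hy ξ hξ, add_zero]
  smul_mem' := fun k x hx ξ hξ => by rw [dotProduct_smul, hx ξ hξ, smul_zero]

/-- For `m = (p, l)`, the tangent direction `T_p l = Hom(L, ℓ/L)` in `T_p ℙ² = Hom(L, ℂ³/L)`. -/
def direction (m : M) : Submodule ℂ (TP (pt m)) where
  carrier := {φ | ∀ x, φ x ∈ (plane m).map (pt m).mkQ}
  zero_mem' := fun _ => Submodule.zero_mem _
  add_mem' := fun hφ hψ x => Submodule.add_mem _ (hφ x) (hψ x)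
  smul_mem' := fun k _ hφ x => Submodule.smul_mem _ k (hφ x)

/-- The contact distribution: the subspace `D_m = (dπ)⁻¹(ℂ v)` of the tangent space of `M` at the
point `m = (z, [v])`. -/
def contact (m : M) : Submodule ℂ (TP (pt m) × TP (ln m)) :=
  ((direction m).comap (dπ m)).map (TM m).subtype

/-- The pairs `(x, ξ)` of homogeneous coordinates of `m`. -/
def Coord (m : M) : Type :=
  {c : V × V // (c.1 ≠ 0 ∧ c.1 ∈ pt m) ∧ (c.2 ≠ 0 ∧ c.2 ∈ ln m)}

/-- The fibre at `m` of the line bundle `O_M(a,b) = π^* O(a) ⊗ π̌^* O(b)`: the functions of the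
homogeneous coordinates `(x, ξ)` of `m` that are homogeneous of degree `a` in `x` and of
degree `b` in `ξ`. -/
def OM (a b : ℤ) (m : M) : Submodule ℂ (Coord m → ℂ) where
  carrier := {f | ∀ (c c' : Coord m) (s t : ℂ),
    c'.1 = (s • c.1.1, t • c.1.2) → f c' = s ^ a * t ^ b * f c}
  zero_mem' := by intro c c' s t _; simp
  add_mem' := by
    intro f g hf hg c c' s t h
    rw [Pi.add_apply, Pi.add_apply, hf c c' s t h, hg c c' s t h]; ring
  smul_mem' := by
    intro k f hf c c' s t h
    rw [Pi.smul_apply, Pi.smul_apply, hf c c' s t h, smul_eq_mul, smul_eq_mul]; ring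

set_option maxSynthPendingDepth 6 in
instance (a b : ℤ) (m : M) : AddCommGroup (contact m ⊗[ℂ] OM a b m) :=
  TensorProduct.addCommGroup

/-- The value of an element of `D_m ⊗ O_M(a,b)_m` at homogeneous coordinates `c` of `m`: the
linear map with `v ⊗ f ↦ f(c) v`. -/
def valueAt (a b : ℤ) {m : M} (c : Coord m) : contact m ⊗[ℂ] OM a b m →ₗ[ℂ] contact m :=
  (TensorProduct.rid ℂ (contact m)).toLinearMap ∘ₗ
    LinearMap.lTensor (contact m) (LinearMap.proj c ∘ₗ (OM a b m).subtype)

/-- The pair `(u, η)` of vectors represents the tangent vector `v` with respect to the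
homogeneous coordinates `c = (x, ξ)`: the tangent vector is the image of the velocity
`(ẋ, ξ̇) = (u, η)` under the quotient map `(x, ξ) ↦ ([x], [ξ])`. -/
def Represents {m : M} (c : Coord m) (v : TP (pt m) × TP (ln m)) (u η : V) : Prop :=
  v.1 ⟨c.1.1, c.2.1.2⟩ = (pt m).mkQ u ∧ v.2 ⟨c.1.2, c.2.2.2⟩ = (ln m).mkQ η

/-- A section of `D ⊗ O_M(a,b)` is holomorphic if, in homogeneous coordinates, it is locally
represented by holomorphic functions. -/
def IsHolomorphic {a b : ℤ} (s : ∀ m : M, contact m ⊗[ℂ] OM a b m) : Prop :=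
  ∀ (m₀ : M) (c₀ : Coord m₀), ∃ (U : Set (V × V)) (u η : V × V → V),
    IsOpen U ∧ c₀.1 ∈ U ∧ DifferentiableOn ℂ u U ∧ DifferentiableOn ℂ η U ∧
      ∀ (m : M) (c : Coord m), c.1 ∈ U →
        Represents c (valueAt a b c (s m)).1 (u c.1) (η c.1)

/-- `H⁰(M, D ⊗ O_M(a,b))`, the space of global holomorphic sections. -/
def H0 (a b : ℤ) : Submodule ℂ (∀ m : M, contact m ⊗[ℂ] OM a b m) where
  carrier := {s | IsHolomorphic s}
  zero_mem' := by
    intro m₀ c₀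
    refine ⟨Set.univ, fun _ => 0, fun _ => 0, isOpen_univ, trivial,
      differentiableOn_const 0, differentiableOn_const 0, fun m c _ => ?_⟩
    constructor <;> simp
  add_mem' := by
    intro s t hs ht m₀ c₀
    obtain ⟨U, u, η, hU, hc, hu, hη, h⟩ := hs m₀ c₀
    obtain ⟨U', u', η', hU', hc', hu', hη', h'⟩ := ht m₀ c₀
    refine ⟨U ∩ U', u + u', η + η', hU.inter hU', ⟨hc, hc'⟩,
      (hu.mono Set.inter_subset_left).add (hu'.mono Set.inter_subset_right),
      (hη.mono Set.inter_subset_left).add (hη'.mono Set.inter_subset_right),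
      fun m c hm => ?_⟩
    have h₁ := h m c hm.1
    have h₂ := h' m c hm.2
    constructor
    · simpa using congrArg₂ (· + ·) h₁.1 h₂.1
    · simpa using congrArg₂ (· + ·) h₁.2 h₂.2
  smul_mem' := by
    intro k s hs m₀ c₀
    obtain ⟨U, u, η, hU, hc, hu, hη, h⟩ := hs m₀ c₀
    refine ⟨U, k • u, k • η, hU, hc, hu.const_smul k, hη.const_smul k, fun m c hm => ?_⟩
    have h₁ := h m c hm
    constructor
    · simpa using congrArg (k • ·) h₁.1
    · simpa using congrArg (k • ·) h₁.2

/-- The space `E(a,b) = ℙ H⁰(M, D ⊗ O_M(a,b))` of second order differential equations of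
bidegree `(a,b)` on the projective plane. -/
abbrev E (a b : ℤ) : Type := ℙ ℂ (H0 a b)

/-- The dimension of the projective space `ℙ K W` of a finite-dimensional space `W`. -/
def projectiveDim (K W : Type*) [Field K] [AddCommGroup W] [Module K W] : ℤ :=
  (Module.finrank K W : ℤ) - 1

/-- The dimension of the projective space `E(a,b)`. -/
def dimE (a b : ℤ) : ℤ := projectiveDim ℂ (H0 a b)

end SecondOrderODE

end

/-!
The contact distribution is the direct sum of the tangent lines of the two fibrations of `M`, and
these line bundles are `O_M(2, -1)` and `O_M(-1, 2)`. Concretely, a contact vector at `(x, ξ)` is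
represented by velocities `(u, η)` with `ξ·u = 0` and `η·x = 0`; as also `ξ·x = 0`, there are
numbers `f`, `g` with `x × u = f ξ` and `ξ × η = g x`, and these determine the vector
(`represents_iff`). Rescaling `(x, ξ)` multiplies them by monomials (`contactCoord_smul`), so that

`H⁰(M, D ⊗ O_M(a, b)) = H⁰(M, O_M(a + 2, b - 1)) ⊕ H⁰(M, O_M(a - 1, b + 2))`  (`H0Equiv`).

For `p, q ≥ 0` a section of `O_M(p, q)` is a bihomogeneous holomorphic function on the cone
`{ξ·x = 0, x ≠ 0, ξ ≠ 0}`, and it is the restriction of a polynomial of bidegree `(p, q)`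
(`HolomorphicOnCone.exists_polynomial`). Indeed `M` is compact, so the function has polynomial
growth on each affine chart `x_i ξ_j ≠ 0`, `i ≠ j`, and is a polynomial in the affine coordinates by
Liouville's theorem (`exists_mvPolynomial_of_growth`). Hence on each chart it is a polynomial
divided by a power of `x_i ξ_j`. In the domain `ℂ[x, ξ] / (ξ·x)` the coordinates are pairwise
non-associated primes (`prime_toRing_X`), so comparing the charts `(i, j)` and `(j, i)` cancels the
denominator (`exists_polynomial_of_charts`).

A polynomial that vanishes on the cone is a multiple of the prime `ξ·x`, by the Nullstellensatz. So
the space of sections of `O_M(p, q)` has dimension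
`(p+1)(p+2)(q+1)(q+2)/4 - p(p+1)q(q+1)/4 = (p+1)(q+1)(p+q+2)/2` (`two_mul_finrank_biHomOn`), and the
sum of the two dimensions is the one claimed.
-/

noncomputable section

namespace SecondOrderODE

/-! ### Liouville's theorem for functions of polynomial growth -/

/-- Liouville's theorem for functions of polynomial growth in one variable: by Cauchy's estimates on
large circles, the Taylor coefficients of order greater than `N` vanish. -/
theorem exists_polynomial_of_growth {f : ℂ → ℂ} (hf : Differentiable ℂ f) {C : ℝ} {N : ℕ}
    (hC : ∀ z, ‖f z‖ ≤ C * (1 + ‖z‖) ^ N) :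
    ∃ p : Polynomial ℂ, p.degree < ((N + 1 : ℕ) : WithBot ℕ) ∧ ∀ z, f z = p.eval z := by
  -- on the circle of radius `R` Cauchy's estimate is `O(R ^ (N - n))`
  have hvan : ∀ n, N < n → iteratedDeriv n f 0 = 0 := by
    intro n hn
    have hlim : Filter.Tendsto (fun R : ℝ => n.factorial * (C * (2 * R) ^ N) / R ^ n)
        Filter.atTop (nhds 0) := by
      have h1 := (tendsto_pow_neg_atTop (𝕜 := ℝ) (n := n - N) (by omega)).const_mul
        (n.factorial * C * 2 ^ N)
      rw [mul_zero] at h1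
      refine h1.congr' ?_
      filter_upwards [Filter.eventually_gt_atTop 0] with R hR
      obtain ⟨k, rfl⟩ := Nat.exists_eq_add_of_lt hn
      rw [zpow_neg, zpow_natCast, show N + k + 1 - N = k + 1 by omega]
      field_simp
      ring
    refine norm_le_zero_iff.1 (ge_of_tendsto hlim ?_)
    filter_upwards [Filter.eventually_ge_atTop 1] with R hR
    have hC0 : 0 ≤ C := by
      have := (norm_nonneg _).trans (hC 0)
      simpa using this
    refine Complex.norm_iteratedDeriv_le_of_forall_mem_sphere_norm_le n (by linarith)
      hf.diffContOnCl fun z hz => (hC z).trans ?_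
    have hz' : ‖z‖ = R := by simpa using hz
    rw [hz']
    gcongr
    linarith
  refine ⟨∑ n ∈ Finset.range (N + 1),
    Polynomial.monomial n ((n.factorial : ℂ)⁻¹ * iteratedDeriv n f 0), ?_, fun z => ?_⟩
  · refine lt_of_le_of_lt (Polynomial.degree_sum_le _ _) ?_
    refine (Finset.sup_lt_iff (WithBot.bot_lt_coe _)).2 fun n hn => ?_
    exact lt_of_le_of_lt (Polynomial.degree_monomial_le _ _)
      (by exact_mod_cast Finset.mem_range.1 hn)
  · rw [← Complex.taylorSeries_eq_of_entire' 0 z hf, Polynomial.eval_finsetSum,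
      tsum_eq_sum (s := Finset.range (N + 1))]
    · simp
    · intro n hn
      rw [hvan n (by simpa using hn)]
      simp

/-- Liouville's theorem for functions of polynomial growth in several variables. The function is
interpolated in its first variable at finitely many nodes, where it is a polynomial in the other
variables by induction. -/
theorem exists_mvPolynomial_of_growth {n : ℕ} {F : (Fin n → ℂ) → ℂ} (hF : Differentiable ℂ F)
    {C : ℝ} {N : ℕ} (hC : ∀ z, ‖F z‖ ≤ C * (1 + ‖z‖) ^ N) :
    ∃ P : MvPolynomial (Fin n) ℂ, ∀ z, F z = MvPolynomial.eval z P := by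
  induction n generalizing C with
  | zero => exact ⟨MvPolynomial.C (F 0), fun z => by simp [Subsingleton.elim z 0]⟩
  | succ n ih =>
    have hC0 : 0 ≤ C := by
      have := (norm_nonneg _).trans (hC 0)
      simpa using this
    have hcons : ∀ (r : ℂ) (z : Fin n → ℂ),
        1 + ‖(Fin.cons r z : Fin (n + 1) → ℂ)‖ ≤ (1 + ‖r‖) * (1 + ‖z‖) := by
      intro r z
      have : ‖(Fin.cons r z : Fin (n + 1) → ℂ)‖ ≤ ‖r‖ + ‖z‖ := by
        refine (pi_norm_le_iff_of_nonneg (by positivity)).2 fun i => ?_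
        refine Fin.cases ?_ (fun j => ?_) i
        · simp
        · simpa using (norm_le_pi_norm z j).trans (le_add_of_nonneg_left (norm_nonneg r))
      nlinarith [mul_nonneg (norm_nonneg r) (norm_nonneg z)]
    have hbd : ∀ (r : ℂ) (z : Fin n → ℂ),
        ‖F (Fin.cons r z)‖ ≤ C * (1 + ‖r‖) ^ N * (1 + ‖z‖) ^ N := by
      intro r z
      refine (hC _).trans ?_
      rw [mul_assoc, ← mul_pow]
      gcongr
      exact hcons r z
    have hd₁ : ∀ z : Fin n → ℂ, Differentiable ℂ fun r : ℂ => F (Fin.cons r z) := by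
      refine fun z => hF.comp (differentiable_pi.2 fun i => ?_)
      refine Fin.cases ?_ (fun j => ?_) i
      · simp
      · simp
    have hd₂ : ∀ r : ℂ, Differentiable ℂ fun z : Fin n → ℂ => F (Fin.cons r z) := by
      refine fun r => hF.comp (differentiable_pi.2 fun i => ?_)
      refine Fin.cases ?_ (fun j => ?_) i
      · simp
      · simpa using differentiable_apply j
    have hP : ∀ k : ℕ, ∃ P : MvPolynomial (Fin n) ℂ,
        ∀ z, F (Fin.cons (k : ℂ) z) = MvPolynomial.eval z P :=
      fun k => ih (hd₂ k) (hbd k)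
    choose P hP using hP
    have hinj : Set.InjOn (fun k : ℕ => (k : ℂ)) (Finset.range (N + 1) : Finset ℕ) :=
      fun i _ j _ h => Nat.cast_injective h
    -- Lagrange interpolation in the variable `0` at the nodes `0, 1, …, N`
    refine ⟨∑ k ∈ Finset.range (N + 1), MvPolynomial.rename Fin.succ (P k) *
      (Polynomial.aeval (MvPolynomial.X 0)
        (Lagrange.basis (Finset.range (N + 1)) (fun k : ℕ => (k : ℂ)) k)), fun z => ?_⟩
    obtain ⟨p, hp, hpe⟩ := exists_polynomial_of_growth (hd₁ (Fin.tail z))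
      (C := C * (1 + ‖Fin.tail z‖) ^ N) (N := N)
      (fun r => (hbd r _).trans_eq (by ring))
    have hint := Lagrange.eq_interpolate hinj (f := p) (by simpa using hp)
    have hz : F z = p.eval (z 0) := by rw [← hpe, Fin.cons_self_tail]
    rw [hz, hint, Lagrange.interpolate_apply, Polynomial.eval_finsetSum, map_sum]
    refine Finset.sum_congr rfl fun k _ => ?_
    rw [Polynomial.eval_mul, Polynomial.eval_C, ← hpe, hP, map_mul, MvPolynomial.eval_rename,
      Polynomial.aeval_def, Polynomial.hom_eval₂, MvPolynomial.eval_X,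
      Polynomial.eval₂_congr (RingHom.ext fun x => by simp :
        (MvPolynomial.eval z).comp (algebraMap ℂ _) = RingHom.id ℂ) rfl rfl, Polynomial.eval₂_id]
    rfl

section Polynomials

open MvPolynomial

/-! ### The coordinate ring of the incidence variety -/

/-- Polynomials in the homogeneous coordinates `x` (indexed by `Sum.inl`) and `ξ` (indexed by
`Sum.inr`). -/
abbrev BiPoly : Type := MvPolynomial (Fin 3 ⊕ Fin 3) ℂ

/-- The value of a polynomial at a pair `c = (x, ξ)`. -/
def ev (c : V × V) : BiPoly →+* ℂ := eval (Sum.elim c.1 c.2)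

@[simp] theorem ev_X_inl (c : V × V) (i : Fin 3) : ev c (X (Sum.inl i)) = c.1 i := by simp [ev]

@[simp] theorem ev_X_inr (c : V × V) (i : Fin 3) : ev c (X (Sum.inr i)) = c.2 i := by simp [ev]

/-- The part `∑ k ∈ s, x_k ξ_k` of the incidence equation. -/
def partialIncidence (s : Finset (Fin 3)) : BiPoly := ∑ k ∈ s, X (Sum.inl k) * X (Sum.inr k)

/-- The incidence equation `x₀ ξ₀ + x₁ ξ₁ + x₂ ξ₂`. -/
def incidence : BiPoly := partialIncidence Finset.univ

theorem ev_incidence (c : V × V) : ev c incidence = c.2 ⬝ᵥ c.1 := by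
  simp [incidence, partialIncidence, dotProduct, mul_comm]

/-- A nondegenerate quadratic form in at least four variables is irreducible. -/
theorem prime_partialIncidence {s : Finset (Fin 3)} (hs : s.Nontrivial) :
    Prime (partialIncidence s) := by
  classical
  have h : partialIncidence s
      = sumSMulXSMulY (Finsupp.indicator s fun _ _ => (1 : ℂ)) := by
    rw [sumSMulXSMulY, Finsupp.linearCombination_apply, partialIncidence,
      Finsupp.sum_of_support_subset (s := s) _ (Finsupp.support_indicator_subset _ _) _ (by simp)]
    refine Finset.sum_congr rfl fun i hi => ?_
    simp [Finsupp.indicator_of_mem hi]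
  have hsupp : (Finsupp.indicator s fun _ _ => (1 : ℂ)).support = s := by
    ext i
    simp [Finsupp.indicator_apply]
  rw [h]
  refine (irreducible_sumSMulXSMulY _ (by rwa [hsupp]) fun r hr => ?_).prime
  obtain ⟨i, hi⟩ := hs.nonempty
  refine isUnit_of_dvd_one ?_
  simpa [Finsupp.indicator_of_mem hi] using hr i

theorem not_partialIncidence_dvd_X (s : Finset (Fin 3)) (v : Fin 3 ⊕ Fin 3) :
    ¬ partialIncidence s ∣ X v := by
  classical
  intro h
  have h' := map_dvd (eval (Pi.single v (1 : ℂ))) h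
  rw [eval_X, Pi.single_eq_same, partialIncidence, map_sum, Finset.sum_eq_zero, zero_dvd_iff] at h'
  · exact one_ne_zero h'
  · rintro k -
    rcases v with i | i <;> simp

theorem prime_incidence : Prime incidence :=
  prime_partialIncidence (by decide)

/-- A polynomial that vanishes at the points of the incidence quadric where `D` does not vanish is
a multiple of the incidence equation, provided that `D` is not: the incidence equation is prime,
so this is the Nullstellensatz. -/
theorem incidence_dvd_of_vanishing {D P : BiPoly} (hD : ¬ incidence ∣ D)
    (h : ∀ c : V × V, c.2 ⬝ᵥ c.1 = 0 → ev c D ≠ 0 → ev c P = 0) : incidence ∣ P := by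
  refine (prime_incidence.dvd_or_dvd (a := D) (b := P) ?_).resolve_left hD
  rw [← Ideal.mem_span_singleton]
  have hprime : (Ideal.span {incidence}).IsPrime :=
    (Ideal.span_singleton_prime prime_incidence.ne_zero).2 prime_incidence
  rw [← hprime.radical, ← vanishingIdeal_zeroLocus_eq_radical (K := ℂ), mem_vanishingIdeal_iff]
  intro z hz
  have hzc : Sum.elim (z ∘ Sum.inl) (z ∘ Sum.inr) = z := Sum.elim_comp_inl_inr z
  have hz' := (mem_zeroLocus_iff.1 hz) incidence (Ideal.mem_span_singleton_self _)
  have hev : ∀ Q : BiPoly, aeval z Q = ev (z ∘ Sum.inl, z ∘ Sum.inr) Q := by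
    intro Q
    simp only [ev, hzc]
    rfl
  rw [hev, ev_incidence] at hz'
  rw [hev, map_mul]
  by_cases h0 : ev (z ∘ Sum.inl, z ∘ Sum.inr) D = 0
  · rw [h0, zero_mul]
  · rw [h _ hz' h0, mul_zero]

/-- The substitution of zero for the variable `v`. -/
def setZero (v : Fin 3 ⊕ Fin 3) : BiPoly →ₐ[ℂ] BiPoly := aeval (Function.update X v 0)

theorem X_dvd_sub_setZero (v : Fin 3 ⊕ Fin 3) (P : BiPoly) : X v ∣ P - setZero v P := by
  induction P using MvPolynomial.induction_on with
  | C a => simp [setZero, algebraMap_eq]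
  | add p q hp hq => rw [map_add, add_sub_add_comm]; exact dvd_add hp hq
  | mul_X p w hp =>
    have hw : (X v : BiPoly) ∣ X w - setZero v (X w) := by
      by_cases h : w = v
      · subst h; simp [setZero]
      · simp [setZero, h]
    rw [map_mul, show p * X w - setZero v p * setZero v (X w)
      = (p - setZero v p) * X w + setZero v p * (X w - setZero v (X w)) by ring]
    exact dvd_add (hp.mul_right _) (hw.mul_left _)

theorem setZero_incidence (v : Fin 3 ⊕ Fin 3) :
    setZero v incidence = partialIncidence (Finset.univ.erase (Sum.elim id id v)) := by
  rw [incidence, partialIncidence, partialIncidence, map_sum,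
    ← Finset.add_sum_erase _ _ (Finset.mem_univ (Sum.elim id id v))]
  have h0 : setZero v (X (Sum.inl (Sum.elim id id v)) * X (Sum.inr (Sum.elim id id v))) = 0 := by
    rcases v with i | i <;> simp [setZero]
  rw [h0, zero_add]
  refine Finset.sum_congr rfl fun k hk => ?_
  have hk' := (Finset.mem_erase.1 hk).1
  have h1 : (Sum.inl k : Fin 3 ⊕ Fin 3) ≠ v := by rintro rfl; exact hk' rfl
  have h2 : (Sum.inr k : Fin 3 ⊕ Fin 3) ≠ v := by rintro rfl; exact hk' rfl
  simp [setZero, h1, h2]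

/-- The homogeneous coordinate ring `ℂ[x, ξ] / (x₀ ξ₀ + x₁ ξ₁ + x₂ ξ₂)` of the incidence
variety. -/
abbrev CoordRing : Type := BiPoly ⧸ Ideal.span {incidence}

/-- The class of a polynomial in the coordinate ring. -/
abbrev toRing : BiPoly →+* CoordRing := Ideal.Quotient.mk _

theorem toRing_eq_zero_iff {P : BiPoly} : toRing P = 0 ↔ incidence ∣ P := by
  rw [Ideal.Quotient.eq_zero_iff_mem, Ideal.mem_span_singleton]

theorem toRing_eq_iff {P Q : BiPoly} : toRing P = toRing Q ↔ incidence ∣ P - Q := by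
  rw [Ideal.Quotient.eq, Ideal.mem_span_singleton]

instance : IsDomain CoordRing :=
  (Ideal.Quotient.isDomain_iff_prime _).2
    ((Ideal.span_singleton_prime prime_incidence.ne_zero).2 prime_incidence)

/-- Modulo the coordinate `v`, the coordinate ring is the quotient of a polynomial ring by the
incidence equation with one term removed. -/
theorem toRing_X_dvd_iff (v : Fin 3 ⊕ Fin 3) (P : BiPoly) :
    toRing (X v) ∣ toRing P ↔
      partialIncidence (Finset.univ.erase (Sum.elim id id v)) ∣ setZero v P := by
  rw [← setZero_incidence]
  constructor
  · rintro ⟨q, hq⟩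
    obtain ⟨Q, rfl⟩ := Ideal.Quotient.mk_surjective q
    rw [← map_mul, toRing_eq_iff] at hq
    have h := map_dvd (setZero v) hq
    have h0 : setZero v (X v) = 0 := by simp [setZero]
    rwa [map_sub, map_mul, h0, zero_mul, sub_zero] at h
  · rintro ⟨r, hr⟩
    obtain ⟨u, hu⟩ := X_dvd_sub_setZero v P
    obtain ⟨w, hw⟩ := X_dvd_sub_setZero v incidence
    refine ⟨toRing (u - w * r), ?_⟩
    rw [← map_mul, toRing_eq_iff]
    exact ⟨r, by linear_combination hu + hr - r * hw⟩

/-- A coordinate `v` is a prime element of the coordinate ring: modulo `v` the incidence equation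
is a quadratic form of rank four, which is irreducible. -/
theorem prime_toRing_X (v : Fin 3 ⊕ Fin 3) : Prime (toRing (X v)) := by
  refine ⟨fun h => not_partialIncidence_dvd_X _ v (toRing_eq_zero_iff.1 h), fun h => ?_, ?_⟩
  · obtain ⟨q, hq⟩ := h.exists_right_inv
    obtain ⟨Q, rfl⟩ := Ideal.Quotient.mk_surjective q
    rw [← map_one toRing, ← map_mul, toRing_eq_iff] at hq
    have h' := map_dvd (eval (0 : Fin 3 ⊕ Fin 3 → ℂ)) hq
    simp [incidence, partialIncidence] at h'
  · intro p q h
    obtain ⟨P, rfl⟩ := Ideal.Quotient.mk_surjective p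
    obtain ⟨Q, rfl⟩ := Ideal.Quotient.mk_surjective q
    rw [← map_mul, toRing_X_dvd_iff, map_mul] at h
    rw [toRing_X_dvd_iff, toRing_X_dvd_iff]
    refine (prime_partialIncidence ?_).dvd_or_dvd h
    generalize Sum.elim id id v = i
    revert i
    decide

theorem not_toRing_X_dvd {v w : Fin 3 ⊕ Fin 3} (h : w ≠ v) : ¬ toRing (X v) ∣ toRing (X w) := by
  rw [toRing_X_dvd_iff]
  simpa [setZero, h] using not_partialIncidence_dvd_X _ w

/-- The product `x_i ξ_j`, whose non-vanishing defines an affine chart when `i ≠ j`. -/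
def chart (i j : Fin 3) : BiPoly := X (Sum.inl i) * X (Sum.inr j)

@[simp] theorem ev_chart (c : V × V) (i j : Fin 3) : ev c (chart i j) = c.1 i * c.2 j := by
  simp [chart]

theorem toRing_chart_ne_zero (i j : Fin 3) : toRing (chart i j) ≠ 0 := by
  rw [chart, map_mul]
  exact mul_ne_zero (prime_toRing_X _).ne_zero (prime_toRing_X _).ne_zero

/-- The primes `x_i`, `ξ_j` dividing the denominator of the chart `(i, j)` do not divide that of the
chart `(j, i)`. -/
theorem chart_pow_dvd {i j : Fin 3} (hij : i ≠ j) {M N : ℕ} {a b : CoordRing}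
    (h : toRing (chart j i) ^ M * a = toRing (chart i j) ^ N * b) :
    toRing (chart i j) ^ N ∣ a := by
  simp only [chart, map_mul] at h ⊢
  have hx := prime_toRing_X (Sum.inl i)
  have hξ := prime_toRing_X (Sum.inr j)
  have hnd : ∀ v : Fin 3 ⊕ Fin 3, v ≠ Sum.inl j → v ≠ Sum.inr i → Prime (toRing (X v)) →
      ¬ toRing (X v) ∣ (toRing (X (Sum.inl j)) * toRing (X (Sum.inr i))) ^ M :=
    fun v h₁ h₂ hv hd => (hv.dvd_or_dvd (hv.dvd_of_dvd_pow hd)).elim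
      (not_toRing_X_dvd h₁.symm) (not_toRing_X_dvd h₂.symm)
  obtain ⟨a', rfl⟩ := hx.pow_dvd_of_dvd_mul_left N (hnd _ (by simpa using hij) (by simp) hx)
    ⟨toRing (X (Sum.inr j)) ^ N * b, by rw [h]; ring⟩
  have h' : (toRing (X (Sum.inl j)) * toRing (X (Sum.inr i))) ^ M * a'
      = toRing (X (Sum.inr j)) ^ N * b :=
    mul_left_cancel₀ (pow_ne_zero N hx.ne_zero) (by linear_combination h)
  obtain ⟨a'', rfl⟩ := hξ.pow_dvd_of_dvd_mul_left N
    (hnd _ (by simp) (by simpa using hij.symm) hξ) ⟨b, h'⟩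
  exact ⟨a'', by ring⟩

/-- The affine cone over `M` without its two vertices: the pairs `(x, ξ)` of homogeneous
coordinates of the points of `M`. -/
def cone : Set (V × V) := {c | c.1 ≠ 0 ∧ c.2 ≠ 0 ∧ c.2 ⬝ᵥ c.1 = 0}

/-- The affine charts `x_i ξ_j ≠ 0`, `i ≠ j`, cover the cone. -/
theorem exists_chart {c : V × V} (hc : c ∈ cone) :
    ∃ i j : Fin 3, i ≠ j ∧ c.1 i * c.2 j ≠ 0 := by
  obtain ⟨hx, hξ, h⟩ := hc
  obtain ⟨i, hi⟩ := Function.ne_iff.1 hx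
  by_contra! h0
  have hj : ∀ j, j ≠ i → c.2 j = 0 := fun j hj =>
    (mul_eq_zero.1 (h0 i j hj.symm)).resolve_left hi
  rw [dotProduct, Finset.sum_eq_single i (fun j _ h => by rw [hj j h, zero_mul]) (by simp)] at h
  refine hξ (funext fun j => ?_)
  by_cases hji : j = i
  · subst hji
    exact (mul_eq_zero.1 h).resolve_right hi
  · exact hj j hji

/-- A function on the cone that in each affine chart `x_i ξ_j ≠ 0`, `i ≠ j`, is a polynomial
divided by a power of `x_i ξ_j`, is a polynomial. The denominators of two charts `(i, j)` and
`(j, i)` are coprime in the coordinate ring, so they cancel. -/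
theorem exists_polynomial_of_charts {f : V × V → ℂ}
    (h : ∀ i j : Fin 3, i ≠ j → ∃ (N : ℕ) (Q : BiPoly), ∀ c : V × V, c.2 ⬝ᵥ c.1 = 0 →
      c.1 i * c.2 j ≠ 0 → (c.1 i * c.2 j) ^ N * f c = ev c Q) :
    ∃ P : BiPoly, ∀ c ∈ cone, f c = ev c P := by
  have hnd : ∀ {D : BiPoly}, toRing D ≠ 0 → ¬ incidence ∣ D :=
    fun hD h => hD (toRing_eq_zero_iff.2 h)
  have hloc : ∀ i j : Fin 3, i ≠ j → ∃ P : BiPoly, ∀ c : V × V, c.2 ⬝ᵥ c.1 = 0 →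
      c.1 i * c.2 j ≠ 0 → f c = ev c P := by
    intro i j hij
    obtain ⟨N, Q, hQ⟩ := h i j hij
    obtain ⟨N', Q', hQ'⟩ := h j i hij.symm
    have heq : toRing (chart j i) ^ N' * toRing Q = toRing (chart i j) ^ N * toRing Q' := by
      simp only [← map_pow, ← map_mul]
      rw [toRing_eq_iff]
      refine incidence_dvd_of_vanishing (D := chart i j * chart j i) (hnd ?_) fun c hc hD => ?_
      · rw [map_mul]
        exact mul_ne_zero (toRing_chart_ne_zero i j) (toRing_chart_ne_zero j i)
      · rw [map_mul, ev_chart, ev_chart] at hD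
        rw [map_sub, map_mul, map_mul, map_pow, map_pow, ev_chart, ev_chart,
          ← hQ c hc (left_ne_zero_of_mul hD), ← hQ' c hc (right_ne_zero_of_mul hD)]
        ring
    obtain ⟨p, hp⟩ := chart_pow_dvd hij heq
    obtain ⟨P, rfl⟩ := Ideal.Quotient.mk_surjective p
    refine ⟨P, fun c hc hne => ?_⟩
    rw [← map_pow, ← map_mul, toRing_eq_iff] at hp
    have h0 := map_dvd (ev c) hp
    rw [ev_incidence, hc, zero_dvd_iff, map_sub, ← hQ c hc hne, map_mul, map_pow, ev_chart,
      sub_eq_zero] at h0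
    exact mul_left_cancel₀ (pow_ne_zero N hne) h0
  obtain ⟨P, hP⟩ := hloc 0 1 (by decide)
  refine ⟨P, fun c hc => ?_⟩
  obtain ⟨i, j, hij, hne⟩ := exists_chart hc
  obtain ⟨P', hP'⟩ := hloc i j hij
  have hdvd : incidence ∣ P' - P := by
    refine incidence_dvd_of_vanishing (D := chart 0 1 * chart i j) (hnd ?_) fun c hc hD => ?_
    · rw [map_mul]
      exact mul_ne_zero (toRing_chart_ne_zero 0 1) (toRing_chart_ne_zero i j)
    · rw [map_mul, ev_chart, ev_chart] at hD
      rw [map_sub, ← hP c hc (left_ne_zero_of_mul hD), ← hP' c hc (right_ne_zero_of_mul hD),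
        sub_self]
  have h0 := map_dvd (ev c) hdvd
  rw [ev_incidence, hc.2.2, zero_dvd_iff, map_sub, sub_eq_zero] at h0
  rw [hP' c hc.2.2 hne, h0]

/-! ### Bihomogeneous holomorphic functions on the cone -/

/-- The bigrading of the polynomial ring: `x` has bidegree `(1, 0)` and `ξ` has bidegree
`(0, 1)`. -/
def bidegree : Fin 3 ⊕ Fin 3 → ℕ × ℕ := Sum.elim (fun _ => (1, 0)) (fun _ => (0, 1))

/-- The space of bihomogeneous polynomials of bidegree `(p, q)`. -/
abbrev biHom (p q : ℕ) : Submodule ℂ BiPoly := weightedHomogeneousSubmodule ℂ bidegree (p, q)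

theorem weight_bidegree (d : Fin 3 ⊕ Fin 3 →₀ ℕ) :
    Finsupp.weight bidegree d = (∑ i, d (Sum.inl i), ∑ i, d (Sum.inr i)) := by
  rw [Finsupp.weight_apply, Finsupp.sum_fintype _ _ (by simp), Fintype.sum_sum_type]
  ext <;> simp [bidegree, Prod.fst_sum, Prod.snd_sum]

theorem ev_smul {m : ℕ × ℕ} {P : BiPoly} (hP : IsWeightedHomogeneous bidegree P m) (s t : ℂ)
    (c : V × V) : ev (s • c.1, t • c.2) P = s ^ m.1 * t ^ m.2 * ev c P := by
  rw [ev, ev, eval_eq', eval_eq', Finset.mul_sum]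
  refine Finset.sum_congr rfl fun d hd => ?_
  have hw := hP (mem_support_iff.1 hd)
  rw [weight_bidegree] at hw
  simp only [Fintype.prod_sum_type, Sum.elim_inl, Sum.elim_inr, Pi.smul_apply, smul_eq_mul,
    mul_pow, Finset.prod_mul_distrib, Finset.prod_pow_eq_pow_sum, ← hw]
  ring

/-- The character `(s, t) ↦ s ^ k * t ^ l` of the torus. -/
def torusChar (m : ℕ × ℕ) : ℂˣ × ℂˣ →* ℂ where
  toFun u := (u.1 : ℂ) ^ m.1 * (u.2 : ℂ) ^ m.2
  map_one' := by simp
  map_mul' u v := by simp; ring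

theorem torusChar_injective : Function.Injective torusChar := by
  have h2 : ∀ k l : ℕ, (2 : ℂ) ^ k = 2 ^ l → k = l := fun k l h =>
    Nat.pow_right_injective le_rfl (by exact_mod_cast h : 2 ^ k = 2 ^ l)
  intro m m' h
  have h1 := DFunLike.congr_fun h (Units.mk0 2 two_ne_zero, 1)
  have h3 := DFunLike.congr_fun h (1, Units.mk0 2 two_ne_zero)
  simp only [torusChar, MonoidHom.coe_mk, OneHom.coe_mk, Units.val_mk0, Units.val_one, one_pow,
    mul_one, one_mul] at h1 h3
  exact Prod.ext (h2 _ _ h1) (h2 _ _ h3)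

/-- If a polynomial transforms at `c` with the weight `s ^ p * t ^ q`, then its value at `c` is that
of its component of bidegree `(p, q)`, because distinct characters of the torus are linearly
independent. -/
theorem ev_component_eq {P : BiPoly} {c : V × V} {m : ℕ × ℕ}
    (h : ∀ s t : ℂ, s ≠ 0 → t ≠ 0 → ev (s • c.1, t • c.2) P = s ^ m.1 * t ^ m.2 * ev c P) :
    ev c (weightedHomogeneousComponent bidegree m P) = ev c P := by
  classical
  set comp := fun n => weightedHomogeneousComponent bidegree n P
  have hfin : (Function.support comp).Finite :=
    weightedHomogeneousComponent_finsupp (w := bidegree) P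
  set T : Finset (ℕ × ℕ) := insert m hfin.toFinset
  have hsum : P = ∑ n ∈ T, comp n := by
    conv_lhs => rw [← sum_weightedHomogeneousComponent bidegree P]
    refine finsum_eq_sum_of_support_subset _ fun n hn => ?_
    exact Finset.mem_coe.2 (Finset.mem_insert_of_mem (hfin.mem_toFinset.2 hn))
  have hli := (linearIndependent_monoidHom (ℂˣ × ℂˣ) ℂ).comp torusChar torusChar_injective
  have h0 := linearIndependent_iff'.1 hli T
    (fun n => ev c (comp n) - if n = m then ev c P else 0) ?_ m (Finset.mem_insert_self _ _)
  · simpa [sub_eq_zero] using h0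
  · funext u
    have h1 := h u.1 u.2 u.1.ne_zero u.2.ne_zero
    have h2 : ev ((u.1 : ℂ) • c.1, (u.2 : ℂ) • c.2) P
        = ∑ n ∈ T, (u.1 : ℂ) ^ n.1 * (u.2 : ℂ) ^ n.2 * ev c (comp n) := by
      conv_lhs => rw [hsum, map_sum]
      exact Finset.sum_congr rfl fun n _ =>
        ev_smul (weightedHomogeneousComponent_isWeightedHomogeneous n P) _ _ _
    rw [h2] at h1
    simp only [Finset.sum_apply, Pi.smul_apply, Function.comp_apply, torusChar, MonoidHom.coe_mk,
      OneHom.coe_mk, smul_eq_mul, sub_mul, Finset.sum_sub_distrib, ite_mul, zero_mul,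
      Finset.sum_ite_eq', Pi.zero_apply]
    rw [if_pos (Finset.mem_insert_self _ _), sub_eq_zero, mul_comm (ev c P), ← h1]
    exact Finset.sum_congr rfl fun n _ => mul_comm _ _

/-- A function on the cone that is locally the restriction of a holomorphic function. -/
def HolomorphicOnCone (f : V × V → ℂ) : Prop :=
  ∀ c ∈ cone, ∃ (U : Set (V × V)) (g : V × V → ℂ), IsOpen U ∧ c ∈ U ∧ DifferentiableOn ℂ g U ∧
    ∀ c' ∈ U ∩ cone, f c' = g c'

/-- A function on the cone that is homogeneous of degree `p` in `x` and of degree `q` in `ξ`. -/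
def BihomogeneousOnCone (p q : ℕ) (f : V × V → ℂ) : Prop :=
  ∀ c ∈ cone, ∀ s t : ℂ, s ≠ 0 → t ≠ 0 → f (s • c.1, t • c.2) = s ^ p * t ^ q * f c

theorem smul_mem_cone {c : V × V} (hc : c ∈ cone) {s t : ℂ} (hs : s ≠ 0) (ht : t ≠ 0) :
    (s • c.1, t • c.2) ∈ cone := by
  refine ⟨smul_ne_zero hs hc.1, smul_ne_zero ht hc.2.1, ?_⟩
  simp [smul_dotProduct, dotProduct_smul, hc.2.2]

/-- The incidence variety is compact, so a holomorphic bihomogeneous function is bounded by its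
homogeneity. -/
theorem HolomorphicOnCone.exists_bound {f : V × V → ℂ} (hf : HolomorphicOnCone f) {p q : ℕ}
    (hom : BihomogeneousOnCone p q f) :
    ∃ C : ℝ, 0 ≤ C ∧ ∀ c ∈ cone, ‖f c‖ ≤ C * ‖c.1‖ ^ p * ‖c.2‖ ^ q := by
  set K : Set (V × V) := (Metric.sphere 0 1 ×ˢ Metric.sphere 0 1) ∩ {c | c.2 ⬝ᵥ c.1 = 0}
  have hK : IsCompact K := by
    refine ((isCompact_sphere 0 1).prod (isCompact_sphere 0 1)).inter_right ?_
    exact isClosed_eq (Continuous.dotProduct continuous_snd continuous_fst) continuous_const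
  have hKc : K ⊆ cone := by
    rintro c ⟨⟨h1, h2⟩, h3⟩
    exact ⟨ne_zero_of_mem_unit_sphere ⟨c.1, h1⟩, ne_zero_of_mem_unit_sphere ⟨c.2, h2⟩, h3⟩
  have hcont : ContinuousOn f cone := by
    intro c hc
    obtain ⟨U, g, hU, hcU, hg, hfg⟩ := hf c hc
    have h1 : ContinuousWithinAt g cone c :=
      (hg.continuousOn.continuousAt (hU.mem_nhds hcU)).continuousWithinAt
    refine h1.congr_of_eventuallyEq ?_ (hfg c ⟨hcU, hc⟩)
    filter_upwards [self_mem_nhdsWithin, mem_nhdsWithin_of_mem_nhds (hU.mem_nhds hcU)] with d h h'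
    exact hfg d ⟨h', h⟩
  obtain ⟨C, hC⟩ := hK.exists_bound_of_continuousOn (hcont.mono hKc)
  refine ⟨max C 0, le_max_right _ _, fun c hc => ?_⟩
  have hx : ‖c.1‖ ≠ 0 := norm_ne_zero_iff.2 hc.1
  have hξ : ‖c.2‖ ≠ 0 := norm_ne_zero_iff.2 hc.2.1
  have hx' : ((‖c.1‖⁻¹ : ℝ) : ℂ) ≠ 0 := by exact_mod_cast inv_ne_zero hx
  have hξ' : ((‖c.2‖⁻¹ : ℝ) : ℂ) ≠ 0 := by exact_mod_cast inv_ne_zero hξ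
  have hcK : (((‖c.1‖⁻¹ : ℝ) : ℂ) • c.1, ((‖c.2‖⁻¹ : ℝ) : ℂ) • c.2) ∈ K := by
    refine ⟨⟨?_, ?_⟩, (smul_mem_cone hc hx' hξ').2.2⟩
    · simp [norm_smul, hx]
    · simp [norm_smul, hξ]
  have h := (hC _ hcK).trans (le_max_left C 0)
  rw [hom c hc _ _ hx' hξ', norm_mul, norm_mul, norm_pow, norm_pow, Complex.norm_real,
    Complex.norm_real, norm_inv, norm_inv, norm_norm, norm_norm] at h
  have h' := mul_le_mul_of_nonneg_right h
    (by positivity : 0 ≤ ‖c.1‖ ^ p * ‖c.2‖ ^ q)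
  calc ‖f c‖ = ‖c.1‖⁻¹ ^ p * ‖c.2‖⁻¹ ^ q * ‖f c‖ * (‖c.1‖ ^ p * ‖c.2‖ ^ q) := by
        rw [inv_pow, inv_pow]
        field_simp
    _ ≤ _ := h'.trans_eq (by ring)

/-- Substituting fractions with denominator `D` into a polynomial and multiplying by a power of
`D` gives a polynomial. -/
theorem exists_clear_denominators {n : ℕ} (P : MvPolynomial (Fin n) ℂ) (A : Fin n → BiPoly)
    (D : BiPoly) : ∃ (N : ℕ) (Q : BiPoly), ∀ c : V × V, ev c D ≠ 0 →
      ev c D ^ N * eval (fun l => ev c (A l) / ev c D) P = ev c Q := by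
  induction P using MvPolynomial.induction_on with
  | C a => exact ⟨0, C a, fun c _ => by simp [ev]⟩
  | add P P' h h' =>
    obtain ⟨N, Q, hQ⟩ := h
    obtain ⟨N', Q', hQ'⟩ := h'
    refine ⟨N + N', D ^ N' * Q + D ^ N * Q', fun c hc => ?_⟩
    rw [map_add, map_add, map_mul, map_mul, map_pow, map_pow, ← hQ c hc, ← hQ' c hc]
    ring
  | mul_X P l h =>
    obtain ⟨N, Q, hQ⟩ := h
    refine ⟨N + 1, Q * A l, fun c hc => ?_⟩
    rw [map_mul, map_mul, ← hQ c hc, eval_X]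
    field_simp
    ring

/-- The affine chart of the incidence variety where `x_i = 1` and `ξ_j = 1`. The coordinates are
`x_j`, `x_k` and `ξ_k`, where `k` is the third index; then `ξ_i` is determined by the incidence
equation. -/
def chartPoint (i j k : Fin 3) (z : Fin 3 → ℂ) : V × V :=
  (fun l => if l = i then 1 else if l = j then z 0 else z 1,
    fun l => if l = j then 1 else if l = k then z 2 else -(z 0 + z 1 * z 2))

theorem univ_eq_of_ne : ∀ {i j k : Fin 3}, i ≠ j → k ≠ i → k ≠ j →
    (Finset.univ : Finset (Fin 3)) = {i, j, k} := by decide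

theorem sum_eq_of_ne {i j k : Fin 3} (hij : i ≠ j) (hki : k ≠ i) (hkj : k ≠ j)
    (g : Fin 3 → ℂ) : ∑ l, g l = g i + g j + g k := by
  rw [univ_eq_of_ne hij hki hkj, Finset.sum_insert (by simp [hij, hki.symm]),
    Finset.sum_pair hkj.symm, add_assoc]

theorem chartPoint_mem_cone {i j k : Fin 3} (hij : i ≠ j) (hki : k ≠ i) (hkj : k ≠ j)
    (z : Fin 3 → ℂ) : chartPoint i j k z ∈ cone := by
  refine ⟨fun h => ?_, fun h => ?_, ?_⟩
  · simpa [chartPoint] using congrFun h i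
  · simpa [chartPoint] using congrFun h j
  · rw [dotProduct, sum_eq_of_ne hij hki hkj]
    simp [chartPoint, hij, hki, hkj, hij.symm, hki.symm]
    ring

theorem differentiable_chartPoint (i j k : Fin 3) : Differentiable ℂ (chartPoint i j k) := by
  refine Differentiable.prodMk (differentiable_pi.2 fun l => ?_) (differentiable_pi.2 fun l => ?_)
  · split_ifs <;> fun_prop
  · split_ifs <;> fun_prop

theorem norm_chartPoint_fst_le (i j k : Fin 3) (z : Fin 3 → ℂ) :
    ‖(chartPoint i j k z).1‖ ≤ 1 + ‖z‖ := by
  refine (pi_norm_le_iff_of_nonneg (by positivity)).2 fun l => ?_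
  have h := norm_le_pi_norm z
  simp only [chartPoint]
  split_ifs
  · simp
  · linarith [h 0]
  · linarith [h 1]

theorem norm_chartPoint_snd_le (i j k : Fin 3) (z : Fin 3 → ℂ) :
    ‖(chartPoint i j k z).2‖ ≤ (1 + ‖z‖) ^ 2 := by
  refine (pi_norm_le_iff_of_nonneg (by positivity)).2 fun l => ?_
  have h := norm_le_pi_norm z
  simp only [chartPoint]
  have hz := norm_nonneg z
  split_ifs
  · rw [norm_one]; nlinarith
  · nlinarith [h 2]
  · rw [norm_neg]
    have h1 : ‖z 1 * z 2‖ ≤ ‖z‖ * ‖z‖ := by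
      rw [norm_mul]
      exact mul_le_mul (h 1) (h 2) (norm_nonneg _) hz
    nlinarith [norm_add_le (z 0) (z 1 * z 2), h 0]

/-- Every point of the quadric with `x_i ξ_j ≠ 0` is a rescaled point of the affine chart. -/
theorem eq_smul_chartPoint {i j k : Fin 3} (hij : i ≠ j) (hki : k ≠ i) (hkj : k ≠ j)
    {c : V × V} (hc : c.2 ⬝ᵥ c.1 = 0) (hi : c.1 i ≠ 0) (hj : c.2 j ≠ 0) :
    c = (c.1 i • (chartPoint i j k ![c.1 j / c.1 i, c.1 k / c.1 i, c.2 k / c.2 j]).1,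
      c.2 j • (chartPoint i j k ![c.1 j / c.1 i, c.1 k / c.1 i, c.2 k / c.2 j]).2) := by
  rw [dotProduct, sum_eq_of_ne hij hki hkj] at hc
  have hl : ∀ l, l = i ∨ l = j ∨ l = k := fun l => by
    have := Finset.mem_univ l
    rw [univ_eq_of_ne hij hki hkj] at this
    simpa using this
  refine Prod.ext (funext fun l => ?_) (funext fun l => ?_)
  · rcases hl l with rfl | rfl | rfl
    · simp [chartPoint]
    · simp [chartPoint, hij.symm]; field_simp
    · simp [chartPoint, hki, hkj]; field_simp
  · rcases hl l with rfl | rfl | rfl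
    · simp [chartPoint, hij, hki.symm]
      field_simp
      linear_combination hc
    · simp [chartPoint]
    · simp [chartPoint, hkj]; field_simp

/-- On each affine chart, a holomorphic bihomogeneous function on the cone has polynomial growth,
so by Liouville's theorem it is a polynomial in the affine coordinates. -/
theorem HolomorphicOnCone.exists_chart_polynomial {f : V × V → ℂ} (hf : HolomorphicOnCone f)
    {p q : ℕ} (hom : BihomogeneousOnCone p q f) {i j : Fin 3} (hij : i ≠ j) :
    ∃ (N : ℕ) (Q : BiPoly), ∀ c : V × V, c.2 ⬝ᵥ c.1 = 0 →
      c.1 i * c.2 j ≠ 0 → (c.1 i * c.2 j) ^ N * f c = ev c Q := by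
  obtain ⟨k, hki, hkj⟩ : ∃ k : Fin 3, k ≠ i ∧ k ≠ j := by
    revert i j; decide
  obtain ⟨C, hC0, hC⟩ := hf.exists_bound hom
  have hmem := chartPoint_mem_cone hij hki hkj
  have hdiff : Differentiable ℂ fun z => f (chartPoint i j k z) := by
    intro z
    obtain ⟨U, g, hU, hzU, hg, hfg⟩ := hf _ (hmem z)
    have hγ := differentiable_chartPoint i j k
    refine (((hg _ hzU).differentiableAt (hU.mem_nhds hzU)).comp z (hγ z)).congr_of_eventuallyEq ?_
    filter_upwards [hγ.continuous.continuousAt.preimage_mem_nhds (hU.mem_nhds hzU)] with w hw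
    exact hfg _ ⟨hw, hmem w⟩
  -- in the chart, `x` grows linearly and `ξ` quadratically
  obtain ⟨P, hP⟩ := exists_mvPolynomial_of_growth hdiff (C := C) (N := p + 2 * q) fun z => by
    refine (hC _ (hmem z)).trans ?_
    rw [pow_add, pow_mul, ← mul_assoc]
    gcongr
    · exact norm_chartPoint_fst_le i j k z
    · exact norm_chartPoint_snd_le i j k z
  -- the affine coordinates `x_j / x_i`, `x_k / x_i`, `ξ_k / ξ_j` with common denominator `x_i ξ_j`
  obtain ⟨N, Q, hQ⟩ := exists_clear_denominators P
    ![chart j j, chart k j, chart i k] (chart i j)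
  refine ⟨N, X (Sum.inl i) ^ p * X (Sum.inr j) ^ q * Q, fun c hc hne => ?_⟩
  have hi := left_ne_zero_of_mul hne
  have hj := right_ne_zero_of_mul hne
  have hfrac : (fun l => ev c ((![chart j j, chart k j, chart i k] : Fin 3 → BiPoly) l)
      / ev c (chart i j)) = ![c.1 j / c.1 i, c.1 k / c.1 i, c.2 k / c.2 j] := by
    funext l
    fin_cases l <;> simp <;> field_simp
  have hQc := hQ c (by rwa [ev_chart])
  rw [hfrac, ev_chart, ← hP] at hQc
  have hfc := hom _ (hmem ![c.1 j / c.1 i, c.1 k / c.1 i, c.2 k / c.2 j]) _ _ hi hj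
  rw [← eq_smul_chartPoint hij hki hkj hc hi hj] at hfc
  rw [map_mul, map_mul, map_pow, map_pow, ev_X_inl, ev_X_inr, ← hQc, hfc]
  ring

/-- The global sections of `O_M(p, q)` for `p, q ≥ 0` are the bihomogeneous polynomials. -/
theorem HolomorphicOnCone.exists_polynomial {f : V × V → ℂ} (hf : HolomorphicOnCone f)
    {p q : ℕ} (hom : BihomogeneousOnCone p q f) :
    ∃ P ∈ biHom p q, ∀ c ∈ cone, f c = ev c P := by
  obtain ⟨P, hP⟩ := exists_polynomial_of_charts fun i j hij => hf.exists_chart_polynomial hom hij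
  refine ⟨_, weightedHomogeneousComponent_isWeightedHomogeneous (w := bidegree) (p, q) P,
    fun c hc => ?_⟩
  rw [ev_component_eq fun s t hs ht => ?_, hP c hc]
  rw [← hP _ (smul_mem_cone hc hs ht), ← hP c hc, hom c hc s t hs ht]

/-! ### The dimension of the space of sections of a line bundle -/

/-- Monomials of bidegree `(p, q)` are pairs of monomials of degrees `p` and `q`. -/
def bidegreeEquiv (p q : ℕ) :
    {d : Fin 3 ⊕ Fin 3 →₀ ℕ | Finsupp.weight bidegree d = (p, q)} ≃
      Sym (Fin 3) p × Sym (Fin 3) q :=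
  ((Finsupp.equivFunOnFinite.trans (Equiv.sumArrowEquivProdArrow _ _ _)).subtypeEquiv
    (q := fun g : (Fin 3 → ℕ) × (Fin 3 → ℕ) => ∑ i, g.1 i = p ∧ ∑ i, g.2 i = q)
    (fun d => by
      rw [Set.mem_ofPred_eq, weight_bidegree, Prod.mk.injEq]
      rfl)).trans
  (Equiv.subtypeProdEquivProd.trans
    (Equiv.prodCongr (Sym.equivNatSumOfFintype _ p).symm (Sym.equivNatSumOfFintype _ q).symm))

/-- Monomials form a basis of the space of bihomogeneous polynomials. -/
def biHomEquiv (p q : ℕ) : biHom p q ≃ₗ[ℂ] (Sym (Fin 3) p × Sym (Fin 3) q →₀ ℂ) :=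
  (LinearEquiv.ofEq _ _ (weightedHomogeneousSubmodule_eq_finsupp_supported ℂ bidegree (p, q))).trans
    ((AddMonoidAlgebra.supportedEquivFinsupp _).trans
      (Finsupp.domLCongr (bidegreeEquiv p q)))

instance (p q : ℕ) : FiniteDimensional ℂ (biHom p q) :=
  Module.Finite.equiv (biHomEquiv p q).symm

theorem two_mul_card_sym (p : ℕ) : 2 * Fintype.card (Sym (Fin 3) p) = (p + 1) * (p + 2) := by
  rw [Sym.card_sym_eq_choose, Fintype.card_fin, show 3 + p - 1 = p + 2 by omega,
    Nat.choose_symm_add]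
  induction p with
  | zero => rfl
  | succ p ih =>
    rw [show p + 1 + 2 = (p + 2) + 1 by ring, Nat.choose_succ_succ' (p + 2) 1,
      Nat.choose_one_right]
    linarith

theorem four_mul_finrank_biHom (p q : ℕ) :
    4 * Module.finrank ℂ (biHom p q) = (p + 1) * (p + 2) * ((q + 1) * (q + 2)) := by
  rw [(biHomEquiv p q).finrank_eq, Module.finrank_finsupp_self, Fintype.card_prod,
    ← two_mul_card_sym, ← two_mul_card_sym]
  ring

theorem incidence_mem_biHom : incidence ∈ biHom 1 1 := by
  rw [incidence, partialIncidence]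
  exact Submodule.sum_mem _ fun i _ => (isWeightedHomogeneous_X ℂ bidegree (Sum.inl i)).mul
    (isWeightedHomogeneous_X ℂ bidegree (Sum.inr i))

variable {ι : Type*}

/-- The restriction of polynomials to a family of pairs `(x, ξ)`. -/
def restrict (c : ι → V × V) : BiPoly →ₗ[ℂ] (ι → ℂ) where
  toFun P i := ev (c i) P
  map_add' P Q := by ext; simp
  map_smul' k P := by ext; simp [ev, smul_eval]

theorem restrict_eq_zero_iff {c : ι → V × V} (hc : Set.range c = cone) {P : BiPoly} :
    restrict c P = 0 ↔ incidence ∣ P := by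
  constructor
  · intro h
    -- a point of the quadric with `x₀ ξ₀ ≠ 0` lies on the cone
    refine incidence_dvd_of_vanishing (D := chart 0 0) (fun h =>
      toRing_chart_ne_zero 0 0 (toRing_eq_zero_iff.2 h)) fun d hd hD => ?_
    rw [ev_chart] at hD
    have hdc : d ∈ cone := by
      refine ⟨fun h => left_ne_zero_of_mul hD ?_, fun h => right_ne_zero_of_mul hD ?_, hd⟩ <;>
        rw [h] <;> rfl
    rw [← hc] at hdc
    obtain ⟨i, rfl⟩ := hdc
    exact congrFun h i
  · rintro ⟨Q, rfl⟩
    funext i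
    have hi : c i ∈ cone := hc ▸ Set.mem_range_self i
    change ev (c i) (incidence * Q) = 0
    rw [map_mul, ev_incidence, hi.2.2, zero_mul]

/-- The space of the restrictions to the cone of bihomogeneous polynomials, where `c` enumerates the
cone. -/
def biHomOn (c : ι → V × V) (p q : ℕ) : Submodule ℂ (ι → ℂ) := (biHom p q).map (restrict c)

instance (c : ι → V × V) (p q : ℕ) : FiniteDimensional ℂ (biHomOn c p q) :=
  inferInstanceAs (FiniteDimensional ℂ ((biHom p q).map (restrict c)))

theorem finrank_biHomOn_add (c : ι → V × V) (p q : ℕ) :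
    Module.finrank ℂ (biHomOn c p q) +
      Module.finrank ℂ (LinearMap.ker ((restrict c).domRestrict (biHom p q))) =
      Module.finrank ℂ (biHom p q) := by
  rw [← LinearMap.finrank_range_add_finrank_ker ((restrict c).domRestrict (biHom p q)),
    LinearMap.range_domRestrict]
  rfl

theorem component_incidence_mul (n : ℕ × ℕ) (Q : BiPoly) :
    weightedHomogeneousComponent bidegree ((1, 1) + n) (incidence * Q) =
      incidence * weightedHomogeneousComponent bidegree n Q := by
  let _ := weightedGradedAlgebra ℂ bidegree
  have h := DirectSum.coe_decompose_mul_add_of_left_mem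
    (weightedHomogeneousSubmodule ℂ bidegree) (j := n) (b := Q) incidence_mem_biHom
  exact (weightedDecomposition.decompose'_apply ℂ bidegree _ _).symm.trans
    (h.trans (congrArg _ (weightedDecomposition.decompose'_apply ℂ bidegree Q n)))

theorem component_incidence_mul_eq_zero {n : ℕ × ℕ} (hn : ¬ (1, 1) ≤ n) (Q : BiPoly) :
    weightedHomogeneousComponent bidegree n (incidence * Q) = 0 := by
  let _ := weightedGradedAlgebra ℂ bidegree
  have h := DirectSum.coe_decompose_mul_of_left_mem_of_not_le
    (weightedHomogeneousSubmodule ℂ bidegree) (b := Q) incidence_mem_biHom hn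
  exact (weightedDecomposition.decompose'_apply ℂ bidegree _ _).symm.trans h

theorem finrank_ker_restrict_of_not_le {c : ι → V × V} (hc : Set.range c = cone) {p q : ℕ}
    (h : ¬ (1, 1) ≤ (p, q)) :
    Module.finrank ℂ (LinearMap.ker ((restrict c).domRestrict (biHom p q))) = 0 := by
  rw [LinearMap.ker_eq_bot.2, finrank_bot]
  refine (injective_iff_map_eq_zero _).2 fun P hP => Subtype.ext ?_
  obtain ⟨Q, hQ⟩ := (restrict_eq_zero_iff hc).1 hP
  have h0 := component_incidence_mul_eq_zero h Q
  exact (weightedHomogeneousComponent_eq_self P.2).symm.trans ((congrArg _ hQ).trans h0)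

/-- The bihomogeneous polynomials of bidegree `(p + 1, q + 1)` that vanish on the cone are the
multiples of the incidence equation by those of bidegree `(p, q)`. -/
theorem finrank_ker_restrict {c : ι → V × V} (hc : Set.range c = cone) (p q : ℕ) :
    Module.finrank ℂ (LinearMap.ker ((restrict c).domRestrict (biHom (p + 1) (q + 1)))) =
      Module.finrank ℂ (biHom p q) := by
  have hdeg : ((1, 1) + (p, q) : ℕ × ℕ) = (p + 1, q + 1) := by ext <;> simp [add_comm]
  have hmul : ∀ P ∈ biHom p q, incidence * P ∈ biHom (p + 1) (q + 1) := fun P hP => by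
    have h := IsWeightedHomogeneous.mul incidence_mem_biHom hP
    rw [hdeg] at h
    exact h
  let μ : biHom p q →ₗ[ℂ] biHom (p + 1) (q + 1) :=
    (LinearMap.mulLeft ℂ incidence).restrict hmul
  have hμ : Function.Injective μ := by
    intro P Q h
    exact Subtype.ext (mul_left_cancel₀ prime_incidence.ne_zero (congrArg Subtype.val h))
  suffices hker : LinearMap.ker ((restrict c).domRestrict (biHom (p + 1) (q + 1))) =
      LinearMap.range μ by
    rw [hker, LinearMap.finrank_range_of_inj hμ]
  ext P
  rw [LinearMap.mem_ker, LinearMap.domRestrict_apply, restrict_eq_zero_iff hc]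
  constructor
  · rintro ⟨Q, hQ⟩
    refine ⟨⟨_, weightedHomogeneousComponent_isWeightedHomogeneous (w := bidegree) (p, q) Q⟩,
      Subtype.ext ?_⟩
    refine (component_incidence_mul (p, q) Q).symm.trans ?_
    rw [hdeg]
    exact (congrArg _ hQ.symm).trans (weightedHomogeneousComponent_eq_self P.2)
  · rintro ⟨Q, rfl⟩
    exact ⟨Q, rfl⟩

/-- The dimension of the space of global sections of `O_M(p, q)`: that of the space of
bihomogeneous polynomials of bidegree `(p, q)` minus that of bidegree `(p - 1, q - 1)`. -/
theorem two_mul_finrank_biHomOn {c : ι → V × V} (hc : Set.range c = cone) (p q : ℕ) :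
    2 * Module.finrank ℂ (biHomOn c p q) = (p + 1) * (q + 1) * (p + q + 2) := by
  have h := finrank_biHomOn_add c p q
  have h4 := four_mul_finrank_biHom p q
  rcases p with _ | p
  · rw [finrank_ker_restrict_of_not_le hc (by simp [Prod.le_def])] at h
    linarith
  rcases q with _ | q
  · rw [finrank_ker_restrict_of_not_le hc (by simp [Prod.le_def])] at h
    linarith
  · rw [finrank_ker_restrict hc] at h
    have h4' := four_mul_finrank_biHom p q
    rw [← h] at h4
    linarith

end Polynomials

/-! ### Cross products -/

open scoped ComplexOrder in
theorem star_dotProduct_self_ne_zero {x : V} (hx : x ≠ 0) : star x ⬝ᵥ x ≠ 0 :=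
  mt dotProduct_star_self_eq_zero.1 hx

theorem mem_span_of_cross_eq_zero {x u : V} (hx : x ≠ 0) (h : x ⨯₃ u = 0) :
    u ∈ Submodule.span ℂ {x} := by
  have h' := cross_cross_eq_smul_sub_smul x u (star x)
  rw [h, map_zero, LinearMap.zero_apply, eq_comm, sub_eq_zero, dotProduct_comm x] at h'
  rw [Submodule.mem_span_singleton]
  refine ⟨(star x ⬝ᵥ x)⁻¹ * (u ⬝ᵥ star x), ?_⟩
  rw [mul_smul, ← h', inv_smul_smul₀ (star_dotProduct_self_ne_zero hx)]

/-- The linear form that takes the value `f` at `u` if `x × u = f ξ`. When `ξ·x = 0`, such an `f`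
exists for the vectors `u` with `ξ·u = 0`; the conjugate of `ξ` extends the form to all `u`. -/
def crossForm (x ξ : V) : V →ₗ[ℂ] ℂ where
  toFun u := star ξ ⬝ᵥ x ⨯₃ u / (star ξ ⬝ᵥ ξ)
  map_add' u v := by rw [map_add, dotProduct_add, add_div]
  map_smul' k u := by simp [dotProduct_smul, mul_div_assoc]

theorem cross_eq_crossForm_smul {x ξ u : V} (hξ : ξ ≠ 0) (hx : ξ ⬝ᵥ x = 0) (hu : ξ ⬝ᵥ u = 0) :
    x ⨯₃ u = crossForm x ξ u • ξ := by
  have h := cross_cross_eq_smul_sub_smul x u ξ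
  rw [dotProduct_comm x, dotProduct_comm u, hx, hu, zero_smul, zero_smul, sub_zero] at h
  have h' := cross_cross_eq_smul_sub_smul' (star ξ) (x ⨯₃ u) ξ
  rw [h, map_zero, eq_comm, sub_eq_zero] at h'
  change _ = (star ξ ⬝ᵥ x ⨯₃ u / (star ξ ⬝ᵥ ξ)) • ξ
  rw [div_eq_inv_mul, mul_smul, dotProduct_comm _ (x ⨯₃ u), ← h',
    inv_smul_smul₀ (star_dotProduct_self_ne_zero hξ)]

/-! ### Homogeneous coordinates -/

/-- Homogeneous coordinates of a varying point of `M`. -/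
abbrev CoordPoint : Type := Σ m : M, Coord m

/-- The pair `(x, ξ)` of homogeneous coordinates. -/
def CoordPoint.val (y : CoordPoint) : V × V := y.2.1

theorem eq_mk_of_mem {p : ℙ ℂ V} {x : V} (hx : x ≠ 0) (h : x ∈ p.submodule) :
    p = Projectivization.mk ℂ x hx := by
  induction p with
  | h y hy =>
    rw [Projectivization.submodule_mk, Submodule.mem_span_singleton] at h
    obtain ⟨a, rfl⟩ := h
    exact ((Projectivization.mk_eq_mk_iff' ℂ _ _ _ _).2 ⟨a, rfl⟩).symm

theorem CoordPoint.val_injective : Function.Injective CoordPoint.val := by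
  rintro ⟨m, c, ⟨hx, hxm⟩, hξ, hξm⟩ ⟨m', c', ⟨hx', hxm'⟩, hξ', hξm'⟩ h
  obtain rfl : c = c' := h
  obtain rfl : m = m' := by
    refine Subtype.ext (Prod.ext ?_ ?_)
    · exact (eq_mk_of_mem hx hxm).trans (eq_mk_of_mem hx hxm').symm
    · exact (eq_mk_of_mem hξ hξm).trans (eq_mk_of_mem hξ hξm').symm
  rfl

variable {m : M}

namespace Coord

theorem pt_eq (c : Coord m) : pt m = Submodule.span ℂ {c.1.1} :=
  (congrArg Projectivization.submodule (eq_mk_of_mem c.2.1.1 c.2.1.2)).trans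
    (Projectivization.submodule_mk _ _)

theorem ln_eq (c : Coord m) : ln m = Submodule.span ℂ {c.1.2} :=
  (congrArg Projectivization.submodule (eq_mk_of_mem c.2.2.1 c.2.2.2)).trans
    (Projectivization.submodule_mk _ _)

theorem incident (c : Coord m) : c.1.2 ⬝ᵥ c.1.1 = 0 := m.2 _ c.2.1.2 _ c.2.2.2

theorem mem_cone (c : Coord m) : c.1 ∈ cone := ⟨c.2.1.1, c.2.2.1, c.incident⟩

theorem exists_smul (c c' : Coord m) :
    ∃ s t : ℂ, s ≠ 0 ∧ t ≠ 0 ∧ c'.1 = (s • c.1.1, t • c.1.2) := by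
  obtain ⟨s, hs⟩ := Submodule.mem_span_singleton.1 (c.pt_eq.le c'.2.1.2)
  obtain ⟨t, ht⟩ := Submodule.mem_span_singleton.1 (c.ln_eq.le c'.2.2.2)
  refine ⟨s, t, ?_, ?_, Prod.ext hs.symm ht.symm⟩
  · rintro rfl; exact c'.2.1.1 (by rw [← hs, zero_smul])
  · rintro rfl; exact c'.2.2.1 (by rw [← ht, zero_smul])

end Coord

theorem CoordPoint.range_val : Set.range CoordPoint.val = cone := by
  refine Set.Subset.antisymm (Set.range_subset_iff.2 fun y => y.2.mem_cone) ?_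
  rintro ⟨x, ξ⟩ ⟨hx, hξ, h⟩
  refine ⟨⟨⟨(Projectivization.mk ℂ x hx, Projectivization.mk ℂ ξ hξ), ?_⟩, ⟨(x, ξ), ?_⟩⟩, rfl⟩
  · intro y hy η hη
    simp only [Projectivization.submodule_mk, Submodule.mem_span_singleton] at hy hη
    obtain ⟨a, rfl⟩ := hy
    obtain ⟨b, rfl⟩ := hη
    simp only at h
    simp [h]
  · refine ⟨⟨hx, ?_⟩, hξ, ?_⟩
    · exact (Projectivization.submodule_mk (K := ℂ) x hx).ge (Submodule.mem_span_singleton_self x)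
    · exact (Projectivization.submodule_mk (K := ℂ) ξ hξ).ge (Submodule.mem_span_singleton_self ξ)

/-- Some homogeneous coordinates of a point of `M`. -/
def someCoord (m : M) : Coord m :=
  ⟨(m.1.1.rep, m.1.2.rep),
    ⟨m.1.1.rep_nonzero, by
      rw [pt, Projectivization.submodule_eq]; exact Submodule.mem_span_singleton_self _⟩,
    ⟨m.1.2.rep_nonzero, by
      rw [ln, Projectivization.submodule_eq]; exact Submodule.mem_span_singleton_self _⟩⟩

/-! ### Coordinates on the contact distribution -/

theorem exists_represents (c : Coord m) (v : TP (pt m) × TP (ln m)) :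
    ∃ u η : V, Represents c v u η := by
  obtain ⟨u, hu⟩ := (pt m).mkQ_surjective (v.1 ⟨c.1.1, c.2.1.2⟩)
  obtain ⟨η, hη⟩ := (ln m).mkQ_surjective (v.2 ⟨c.1.2, c.2.2.2⟩)
  exact ⟨u, η, hu.symm, hη.symm⟩

theorem Represents.ext {c : Coord m} {v v' : TP (pt m) × TP (ln m)} {u η : V}
    (h : Represents c v u η) (h' : Represents c v' u η) : v = v' := by
  refine Prod.ext (LinearMap.ext fun x => ?_) (LinearMap.ext fun ξ => ?_)
  · obtain ⟨k, hk⟩ := Submodule.mem_span_singleton.1 (c.pt_eq.le x.2)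
    obtain rfl : k • (⟨c.1.1, c.2.1.2⟩ : pt m) = x := Subtype.ext hk
    rw [map_smul, map_smul, h.1, h'.1]
  · obtain ⟨k, hk⟩ := Submodule.mem_span_singleton.1 (c.ln_eq.le ξ.2)
    obtain rfl : k • (⟨c.1.2, c.2.2.2⟩ : ln m) = ξ := Subtype.ext hk
    rw [map_smul, map_smul, h.2, h'.2]

theorem represents_smul {c c' : Coord m} {s t : ℂ} (hc : c'.1 = (s • c.1.1, t • c.1.2))
    {v : TP (pt m) × TP (ln m)} {u η : V} (h : Represents c v u η) :
    Represents c' v (s • u) (t • η) := by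
  have h₁ : (⟨c'.1.1, c'.2.1.2⟩ : pt m) = s • ⟨c.1.1, c.2.1.2⟩ :=
    Subtype.ext (congrArg Prod.fst hc)
  have h₂ : (⟨c'.1.2, c'.2.2.2⟩ : ln m) = t • ⟨c.1.2, c.2.2.2⟩ :=
    Subtype.ext (congrArg Prod.snd hc)
  exact ⟨by rw [h₁, map_smul, map_smul, h.1], by rw [h₂, map_smul, map_smul, h.2]⟩

theorem exists_of_represents (c : Coord m) (u η : V) :
    ∃ v : TP (pt m) × TP (ln m), Represents c v u η := by
  have key : ∀ (L : Submodule ℂ V) (x : L) (w : V ⧸ L), (x : V) ≠ 0 →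
      ∃ φ : TP L, φ x = w := by
    intro L x w hx
    obtain ⟨g, hg⟩ := SeparatingDual.exists_eq_one (R := ℂ) hx
    exact ⟨(g.toLinearMap.domRestrict L).smulRight w, by simp [hg]⟩
  obtain ⟨φ, hφ⟩ := key (pt m) ⟨c.1.1, c.2.1.2⟩ ((pt m).mkQ u) c.2.1.1
  obtain ⟨ψ, hψ⟩ := key (ln m) ⟨c.1.2, c.2.2.2⟩ ((ln m).mkQ η) c.2.2.1
  exact ⟨(φ, ψ), hφ, hψ⟩

theorem mem_plane_iff (c : Coord m) (u : V) : u ∈ plane m ↔ c.1.2 ⬝ᵥ u = 0 := by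
  refine ⟨fun h => h _ c.2.2.2, fun h ξ hξ => ?_⟩
  obtain ⟨k, rfl⟩ := Submodule.mem_span_singleton.1 (c.ln_eq.le hξ)
  rw [smul_dotProduct, h, smul_zero]

/-- A tangent vector `(u, η)` of `ℙ² × ℙ̌²` at `(x, ξ)` lies in the contact distribution if and only
if `ξ·u = 0` and `η·x = 0`. -/
theorem mem_contact_iff {c : Coord m} {v : TP (pt m) × TP (ln m)} {u η : V}
    (h : Represents c v u η) : v ∈ contact m ↔ c.1.2 ⬝ᵥ u = 0 ∧ η ⬝ᵥ c.1.1 = 0 := by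
  constructor
  · rintro ⟨w, hw, rfl⟩
    obtain ⟨y, hy, hyw⟩ := hw ⟨c.1.1, c.2.1.2⟩
    have hu : c.1.2 ⬝ᵥ u = 0 := by
      have h1 : u - y ∈ pt m := (Submodule.Quotient.eq _).1 (h.1.symm.trans hyw.symm)
      have h2 : c.1.2 ⬝ᵥ (u - y) = 0 := m.2 _ h1 _ c.2.2.2
      rw [dotProduct_sub, hy _ c.2.2.2, sub_zero] at h2
      exact h2
    refine ⟨hu, ?_⟩
    have h3 := w.2 ⟨c.1.1, c.2.1.2⟩ ⟨c.1.2, c.2.2.2⟩ u η h.1 h.2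
    simpa [hu] using h3
  · rintro ⟨hu, hη⟩
    have hfst : ∀ x : pt m, ∃ k : ℂ, (x : V) = k • c.1.1 ∧ v.1 x = (pt m).mkQ (k • u) := by
      intro x
      obtain ⟨k, hk⟩ := Submodule.mem_span_singleton.1 (c.pt_eq.le x.2)
      obtain rfl : k • (⟨c.1.1, c.2.1.2⟩ : pt m) = x := Subtype.ext hk
      exact ⟨k, rfl, by rw [map_smul, map_smul, h.1]⟩
    have hsnd : ∀ ξ : ln m, ∃ k : ℂ, (ξ : V) = k • c.1.2 ∧ v.2 ξ = (ln m).mkQ (k • η) := by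
      intro ξ
      obtain ⟨k, hk⟩ := Submodule.mem_span_singleton.1 (c.ln_eq.le ξ.2)
      obtain rfl : k • (⟨c.1.2, c.2.2.2⟩ : ln m) = ξ := Subtype.ext hk
      exact ⟨k, rfl, by rw [map_smul, map_smul, h.2]⟩
    have hTM : v ∈ TM m := by
      intro x ξ u' η' hu' hη'
      obtain ⟨k, hk, hkv⟩ := hfst x
      obtain ⟨l, hl, hlv⟩ := hsnd ξ
      have h1 : u' - k • u ∈ pt m := (Submodule.Quotient.eq _).1 (hu'.symm.trans hkv)
      have h2 : η' - l • η ∈ ln m := (Submodule.Quotient.eq _).1 (hη'.symm.trans hlv)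
      have h3 := m.2 _ h1 ξ ξ.2
      have h4 := m.2 x x.2 _ h2
      rw [dotProduct_sub, hl, dotProduct_smul, smul_dotProduct, smul_dotProduct, hu, smul_zero,
        smul_zero, sub_zero] at h3
      rw [sub_dotProduct, hk, dotProduct_smul, smul_dotProduct, dotProduct_smul, hη, smul_zero,
        smul_zero, sub_zero] at h4
      rw [hl, hk, smul_dotProduct, dotProduct_smul, h3, h4, add_zero]
    refine ⟨⟨v, hTM⟩, fun x => ?_, rfl⟩
    obtain ⟨k, -, hkv⟩ := hfst x
    exact ⟨k • u, (plane m).smul_mem k ((mem_plane_iff c u).2 hu), hkv.symm⟩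

theorem pt_le_ker_crossForm (c : Coord m) : pt m ≤ LinearMap.ker (crossForm c.1.1 c.1.2) := by
  refine c.pt_eq.le.trans ?_
  rw [Submodule.span_singleton_le_iff_mem, LinearMap.mem_ker]
  simp [crossForm]

theorem ln_le_ker_crossForm (c : Coord m) : ln m ≤ LinearMap.ker (crossForm c.1.2 c.1.1) := by
  refine c.ln_eq.le.trans ?_
  rw [Submodule.span_singleton_le_iff_mem, LinearMap.mem_ker]
  simp [crossForm]

/-- The linear coordinates `(f, g)` of a tangent vector with respect to homogeneous coordinates
`(x, ξ)`. For a vector of the contact distribution represented by `(u, η)`, they are determined by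
`x × u = f ξ` and `ξ × η = g x`. -/
def contactCoord (c : Coord m) : TP (pt m) × TP (ln m) →ₗ[ℂ] ℂ × ℂ :=
  LinearMap.prodMap
    ((pt m).liftQ _ (pt_le_ker_crossForm c) ∘ₗ LinearMap.applyₗ ⟨c.1.1, c.2.1.2⟩)
    ((ln m).liftQ _ (ln_le_ker_crossForm c) ∘ₗ LinearMap.applyₗ ⟨c.1.2, c.2.2.2⟩)

theorem Represents.contactCoord_eq {c : Coord m} {v : TP (pt m) × TP (ln m)} {u η : V}
    (h : Represents c v u η) :
    contactCoord c v = (crossForm c.1.1 c.1.2 u, crossForm c.1.2 c.1.1 η) :=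
  Prod.ext (congrArg ((pt m).liftQ _ (pt_le_ker_crossForm c)) h.1)
    (congrArg ((ln m).liftQ _ (ln_le_ker_crossForm c)) h.2)

theorem represents_iff {c : Coord m} {v : TP (pt m) × TP (ln m)} (hv : v ∈ contact m) {u η : V} :
    Represents c v u η ↔ c.1.1 ⨯₃ u = (contactCoord c v).1 • c.1.2 ∧
      c.1.2 ⨯₃ η = (contactCoord c v).2 • c.1.1 := by
  have hdir : ∀ {u η : V}, Represents c v u η → c.1.1 ⨯₃ u = (contactCoord c v).1 • c.1.2 ∧
      c.1.2 ⨯₃ η = (contactCoord c v).2 • c.1.1 := by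
    intro u η h
    obtain ⟨hu, hη⟩ := (mem_contact_iff h).1 hv
    rw [h.contactCoord_eq]
    exact ⟨cross_eq_crossForm_smul c.2.2.1 c.incident hu,
      cross_eq_crossForm_smul c.2.1.1 (by rw [dotProduct_comm, c.incident])
        (by rw [dotProduct_comm, hη])⟩
  refine ⟨hdir, fun ⟨hu, hη⟩ => ?_⟩
  obtain ⟨u₀, η₀, h₀⟩ := exists_represents c v
  obtain ⟨hu₀, hη₀⟩ := hdir h₀
  constructor
  · rw [h₀.1]
    refine (Submodule.Quotient.eq _).2 ?_
    refine c.pt_eq.ge ?_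
    exact mem_span_of_cross_eq_zero c.2.1.1 (by rw [map_sub, hu₀, hu, sub_self])
  · rw [h₀.2]
    refine (Submodule.Quotient.eq _).2 ?_
    refine c.ln_eq.ge ?_
    exact mem_span_of_cross_eq_zero c.2.2.1 (by rw [map_sub, hη₀, hη, sub_self])

theorem eq_zero_of_contactCoord_eq_zero {c : Coord m} {v : TP (pt m) × TP (ln m)}
    (hv : v ∈ contact m) (h : contactCoord c v = 0) : v = 0 := by
  have h₁ : Represents c v 0 0 := (represents_iff hv).2 (by simp [h])
  exact h₁.ext (represents_iff (Submodule.zero_mem _) |>.2 (by simp))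

/-- A vector `u` with `x × u = k ξ`, constructed from an auxiliary vector `w` that is not
orthogonal to `x`. -/
theorem cross_smul_cross {x ξ w : V} (h : ξ ⬝ᵥ x = 0) (hw : w ⬝ᵥ x ≠ 0) (k : ℂ) :
    x ⨯₃ ((k / (w ⬝ᵥ x)) • (ξ ⨯₃ w)) = k • ξ := by
  rw [map_smul, cross_cross_eq_smul_sub_smul', h, zero_smul, sub_zero, smul_smul,
    dotProduct_comm x, div_mul_cancel₀ _ hw]

theorem exists_contactCoord_eq (c : Coord m) (k l : ℂ) :
    ∃ v ∈ contact m, contactCoord c v = (k, l) := by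
  have hx := star_dotProduct_self_ne_zero c.2.1.1
  have hξ := star_dotProduct_self_ne_zero c.2.2.1
  have hinc := c.incident
  obtain ⟨v, hv⟩ := exists_of_represents c ((k / (star c.1.1 ⬝ᵥ c.1.1)) • c.1.2 ⨯₃ star c.1.1)
    ((l / (star c.1.2 ⬝ᵥ c.1.2)) • c.1.1 ⨯₃ star c.1.2)
  have hvc : v ∈ contact m := by
    rw [mem_contact_iff hv]
    constructor
    · rw [dotProduct_smul, dot_self_cross, smul_zero]
    · rw [dotProduct_comm, dotProduct_smul, dot_self_cross, smul_zero]
  refine ⟨v, hvc, ?_⟩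
  obtain ⟨h₁, h₂⟩ := (represents_iff hvc).1 hv
  rw [cross_smul_cross hinc hx] at h₁
  rw [cross_smul_cross (by rwa [dotProduct_comm]) hξ] at h₂
  exact Prod.ext (smul_left_injective ℂ c.2.2.1 h₁).symm (smul_left_injective ℂ c.2.1.1 h₂).symm

/-- The splitting of the contact distribution as `O_M(2, -1) ⊕ O_M(-1, 2)`: the two coordinates are
homogeneous of these bidegrees. -/
theorem contactCoord_smul {c c' : Coord m} {s t : ℂ} (hc : c'.1 = (s • c.1.1, t • c.1.2))
    (hs : s ≠ 0) (ht : t ≠ 0) {v : TP (pt m) × TP (ln m)} (hv : v ∈ contact m) :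
    contactCoord c' v =
      (s ^ 2 * t⁻¹ * (contactCoord c v).1, s⁻¹ * t ^ 2 * (contactCoord c v).2) := by
  obtain ⟨u, η, h⟩ := exists_represents c v
  obtain ⟨h₁, h₂⟩ := (represents_iff hv).1 h
  obtain ⟨h₁', h₂'⟩ := (represents_iff hv).1 (represents_smul hc h)
  simp only [hc, map_smul, LinearMap.smul_apply, h₁, h₂, smul_smul] at h₁' h₂'
  have e₁ := smul_left_injective ℂ c.2.2.1 h₁'
  have e₂ := smul_left_injective ℂ c.2.1.1 h₂'
  refine Prod.ext ?_ ?_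
  · field_simp
    linear_combination -e₁
  · field_simp
    linear_combination -e₂

/-! ### Coordinates of sections -/

variable {a b : ℤ}

/-- There is a function of the homogeneous coordinates in the fibre of `O_M(a, b)` that takes the
value `1` at `c`. -/
theorem exists_OM_eq_one (a b : ℤ) (c : Coord m) : ∃ e : OM a b m, (e : Coord m → ℂ) c = 1 := by
  obtain ⟨i, hi⟩ := Function.ne_iff.1 c.2.1.1
  obtain ⟨j, hj⟩ := Function.ne_iff.1 c.2.2.1
  refine ⟨⟨fun d => (d.1.1 i / c.1.1 i) ^ a * (d.1.2 j / c.1.2 j) ^ b, ?_⟩, ?_⟩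
  · intro d d' s t h
    simp only [h, Pi.smul_apply, smul_eq_mul, mul_div_assoc, mul_zpow]
    ring
  · change (c.1.1 i / c.1.1 i) ^ a * (c.1.2 j / c.1.2 j) ^ b = 1
    rw [div_self hi, div_self hj, one_zpow, one_zpow, mul_one]

theorem evalOM_bijective (a b : ℤ) (c : Coord m) :
    Function.Bijective ((LinearMap.proj c : (Coord m → ℂ) →ₗ[ℂ] ℂ) ∘ₗ (OM a b m).subtype) := by
  constructor
  · refine (injective_iff_map_eq_zero _).2 fun f hf => Subtype.ext (funext fun c' => ?_)
    obtain ⟨s, t, -, -, h⟩ := c.exists_smul c'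
    have hf' : (f : Coord m → ℂ) c = 0 := hf
    rw [f.2 c c' s t h, hf', mul_zero]
    rfl
  · intro k
    obtain ⟨e, he⟩ := exists_OM_eq_one a b c
    exact ⟨k • e, by simp [he]⟩

/-- Homogeneous coordinates of `m` trivialize the fibre of `O_M(a, b)`, so an element of
`D_m ⊗ O_M(a, b)_m` is determined by its value there, which is arbitrary. -/
theorem valueAt_bijective (a b : ℤ) (c : Coord m) : Function.Bijective (valueAt a b c) := by
  have h : valueAt a b c = (LinearEquiv.lTensor (contact m)
      (LinearEquiv.ofBijective _ (evalOM_bijective a b c)) ≪≫ₗ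
        TensorProduct.rid ℂ (contact m)).toLinearMap := rfl
  rw [h]
  exact LinearEquiv.bijective _

theorem valueAt_smul {c c' : Coord m} {s t : ℂ} (hc : c'.1 = (s • c.1.1, t • c.1.2))
    (τ : contact m ⊗[ℂ] OM a b m) : valueAt a b c' τ = (s ^ a * t ^ b) • valueAt a b c τ := by
  have h : (LinearMap.proj c' : (Coord m → ℂ) →ₗ[ℂ] ℂ) ∘ₗ (OM a b m).subtype =
      (s ^ a * t ^ b) • ((LinearMap.proj c : (Coord m → ℂ) →ₗ[ℂ] ℂ) ∘ₗ (OM a b m).subtype) :=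
    LinearMap.ext fun f => f.2 c c' s t hc
  rw [valueAt, h, LinearMap.lTensor_smul, LinearMap.comp_smul, LinearMap.smul_apply]
  rfl

/-- The two coordinates of a section of `D ⊗ O_M(a, b)`, as functions of the homogeneous
coordinates. -/
def sectionCoord (s : ∀ m : M, contact m ⊗[ℂ] OM a b m) (y : CoordPoint) : ℂ × ℂ :=
  contactCoord y.2 (valueAt a b y.2 (s y.1)).1

theorem sectionCoord_smul (σ : ∀ m : M, contact m ⊗[ℂ] OM a b m) {c c' : Coord m} {s t : ℂ}
    (hs : s ≠ 0) (ht : t ≠ 0) (hc : c'.1 = (s • c.1.1, t • c.1.2)) :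
    sectionCoord σ ⟨m, c'⟩ = (s ^ (a + 2) * t ^ (b - 1) * (sectionCoord σ ⟨m, c⟩).1,
      s ^ (a - 1) * t ^ (b + 2) * (sectionCoord σ ⟨m, c⟩).2) := by
  have h := contactCoord_smul hc hs ht (valueAt a b c' (σ m)).2
  simp only [sectionCoord]
  rw [h, valueAt_smul hc]
  simp only [Submodule.coe_smul, map_smul, Prod.smul_fst, Prod.smul_snd, smul_eq_mul]
  rw [zpow_add₀ hs, zpow_sub₀ ht, zpow_sub₀ hs, zpow_add₀ ht, zpow_one, zpow_one]
  refine Prod.ext ?_ ?_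
  · change s ^ 2 * t⁻¹ * (s ^ a * t ^ b * _) = s ^ a * s ^ (2 : ℤ) * (t ^ b / t) * _
    norm_cast
    ring
  · change s⁻¹ * t ^ 2 * (s ^ a * t ^ b * _) = s ^ a / s * (t ^ b * t ^ (2 : ℤ)) * _
    norm_cast
    ring

theorem sectionCoord_injective {s s' : ∀ m : M, contact m ⊗[ℂ] OM a b m}
    (h : sectionCoord s = sectionCoord s') : s = s' := by
  funext m
  refine (valueAt_bijective a b (someCoord m)).1 ?_
  rw [← sub_eq_zero]
  refine Subtype.ext (eq_zero_of_contactCoord_eq_zero (c := someCoord m) (Subtype.prop _) ?_)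
  rw [Submodule.coe_sub, map_sub, sub_eq_zero]
  exact congrFun h ⟨m, someCoord m⟩

/-! ### Holomorphic sections -/

theorem cross_apply_eq (x u : V) (j : Fin 3) :
    (x ⨯₃ u) j = x (j + 1) * u (j + 2) - x (j + 2) * u (j + 1) := by
  fin_cases j <;> simp [cross_apply]

theorem differentiableOn_cross {f g : V × V → V} {U : Set (V × V)} (hf : DifferentiableOn ℂ f U)
    (hg : DifferentiableOn ℂ g U) : DifferentiableOn ℂ (fun z => f z ⨯₃ g z) U := by
  refine differentiableOn_pi.2 fun j => ?_
  simp only [cross_apply_eq]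
  have hf' := differentiableOn_pi.1 hf
  have hg' := differentiableOn_pi.1 hg
  exact ((hf' _).mul (hg' _)).sub ((hf' _).mul (hg' _))

theorem differentiable_ev (P : BiPoly) : Differentiable ℂ fun z => ev z P := by
  induction P using MvPolynomial.induction_on with
  | C k => simp [ev]
  | add P Q hP hQ => simpa only [map_add] using! hP.add hQ
  | mul_X P v hP =>
    simp only [map_mul]
    refine hP.mul ?_
    rcases v with i | i
    · simp only [ev_X_inl]; fun_prop
    · simp only [ev_X_inr]; fun_prop

/-- The extension by zero of a function of homogeneous coordinates to all pairs of vectors. -/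
def extend (f : CoordPoint → ℂ) : V × V → ℂ := Function.extend CoordPoint.val f 0

theorem extend_val (f : CoordPoint → ℂ) (y : CoordPoint) : extend f y.val = f y :=
  CoordPoint.val_injective.extend_apply f 0 y

/-- A function `f` is holomorphic on the cone if the product `f w` is, for a holomorphic vector
field `w` without zeros on the cone. -/
theorem holomorphicOnCone_extend {f : CoordPoint → ℂ} {w : V × V → V} (hw : Differentiable ℂ w)
    (hw0 : ∀ z ∈ cone, w z ≠ 0)
    (h : ∀ z ∈ cone, ∃ (U : Set (V × V)) (g : V × V → V), IsOpen U ∧ z ∈ U ∧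
      DifferentiableOn ℂ g U ∧ ∀ y : CoordPoint, y.val ∈ U → g y.val = f y • w y.val) :
    HolomorphicOnCone (extend f) := by
  intro z hz
  obtain ⟨U, g, hU, hzU, hg, hfg⟩ := h z hz
  obtain ⟨j, hj⟩ := Function.ne_iff.1 (hw0 z hz)
  have hwj : Differentiable ℂ fun z => w z j := differentiable_pi.1 hw j
  refine ⟨U ∩ {z | w z j ≠ 0}, fun z => g z j / w z j,
    hU.inter (isOpen_ne_fun hwj.continuous continuous_const), ⟨hzU, hj⟩, ?_, ?_⟩
  · have hgj : DifferentiableOn ℂ (fun z => g z j) (U ∩ {z | w z j ≠ 0}) :=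
      (differentiableOn_pi.1 hg j).mono Set.inter_subset_left
    simp only [div_eq_mul_inv]
    exact hgj.mul (hwj.differentiableOn.inv fun z hz => hz.2)
  · rintro z' ⟨⟨hz'U, hz'j⟩, hz'⟩
    rw [← CoordPoint.range_val] at hz'
    obtain ⟨y, rfl⟩ := hz'
    have hz'j' : w y.val j ≠ 0 := hz'j
    change _ = g y.val j / w y.val j
    rw [extend_val, hfg y hz'U, Pi.smul_apply, smul_eq_mul, mul_div_cancel_right₀ _ hz'j']

theorem bihomogeneousOnCone_extend {f : CoordPoint → ℂ} {p q : ℕ}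
    (h : ∀ (m : M) (c c' : Coord m) (s t : ℂ), s ≠ 0 → t ≠ 0 →
      c'.1 = (s • c.1.1, t • c.1.2) → f ⟨m, c'⟩ = s ^ p * t ^ q * f ⟨m, c⟩) :
    BihomogeneousOnCone p q (extend f) := by
  intro z hz s t hs ht
  rw [← CoordPoint.range_val] at hz
  obtain ⟨⟨m, c⟩, rfl⟩ := hz
  let c' : Coord m := ⟨(s • c.1.1, t • c.1.2), ⟨smul_ne_zero hs c.2.1.1, (pt m).smul_mem s c.2.1.2⟩,
    ⟨smul_ne_zero ht c.2.2.1, (ln m).smul_mem t c.2.2.2⟩⟩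
  rw [extend_val, ← h m c c' s t hs ht rfl]
  exact extend_val f ⟨m, c'⟩

theorem mem_biHomOn_of_extend {f : CoordPoint → ℂ} {p q : ℕ} (hf : HolomorphicOnCone (extend f))
    (hom : BihomogeneousOnCone p q (extend f)) : f ∈ biHomOn CoordPoint.val p q := by
  obtain ⟨P, hP, h⟩ := hf.exists_polynomial hom
  refine ⟨P, hP, funext fun y => ?_⟩
  exact (h _ y.2.mem_cone).symm.trans (extend_val f y)

theorem sectionCoord_fst_mem {s : ∀ m : M, contact m ⊗[ℂ] OM a b m} (hs : IsHolomorphic s)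
    {p q : ℕ} (hp : (p : ℤ) = a + 2) (hq : (q : ℤ) = b - 1) :
    (fun y => (sectionCoord s y).1) ∈ biHomOn CoordPoint.val p q := by
  refine mem_biHomOn_of_extend (holomorphicOnCone_extend (w := Prod.snd) differentiable_snd
    (fun z hz => hz.2.1) fun z hz => ?_) (bihomogeneousOnCone_extend fun m c c' σ τ hσ hτ h => ?_)
  · rw [← CoordPoint.range_val] at hz
    obtain ⟨⟨m, c⟩, rfl⟩ := hz
    obtain ⟨U, u, η, hU, hcU, hu, -, hrep⟩ := hs m c
    exact ⟨U, fun z => z.1 ⨯₃ u z, hU, hcU, differentiableOn_cross differentiableOn_fst hu,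
      fun y hy => ((represents_iff (Subtype.prop _)).1 (hrep y.1 y.2 hy)).1⟩
  · rw [sectionCoord_smul s hσ hτ h, ← hp, ← hq, zpow_natCast, zpow_natCast]

theorem sectionCoord_snd_mem {s : ∀ m : M, contact m ⊗[ℂ] OM a b m} (hs : IsHolomorphic s)
    {p q : ℕ} (hp : (p : ℤ) = a - 1) (hq : (q : ℤ) = b + 2) :
    (fun y => (sectionCoord s y).2) ∈ biHomOn CoordPoint.val p q := by
  refine mem_biHomOn_of_extend (holomorphicOnCone_extend (w := Prod.fst) differentiable_fst
    (fun z hz => hz.1) fun z hz => ?_) (bihomogeneousOnCone_extend fun m c c' σ τ hσ hτ h => ?_)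
  · rw [← CoordPoint.range_val] at hz
    obtain ⟨⟨m, c⟩, rfl⟩ := hz
    obtain ⟨U, u, η, hU, hcU, -, hη, hrep⟩ := hs m c
    exact ⟨U, fun z => z.2 ⨯₃ η z, hU, hcU, differentiableOn_cross differentiableOn_snd hη,
      fun y hy => ((represents_iff (Subtype.prop _)).1 (hrep y.1 y.2 hy)).2⟩
  · rw [sectionCoord_smul s hσ hτ h, ← hp, ← hq, zpow_natCast, zpow_natCast]

theorem differentiableOn_smul_cross (P : BiPoly) {f g : V × V → V} (hf : Differentiable ℂ f)
    (hg : Differentiable ℂ g) (w : V) :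
    DifferentiableOn ℂ (fun z => (ev z P / (w ⬝ᵥ f z)) • (g z ⨯₃ w)) {z | w ⬝ᵥ f z ≠ 0} := by
  have hd : Differentiable ℂ fun z => w ⬝ᵥ f z := by
    have hf' := differentiable_pi.1 hf
    simp only [dotProduct]
    fun_prop
  have hq : DifferentiableOn ℂ (fun z => ev z P / (w ⬝ᵥ f z)) {z | w ⬝ᵥ f z ≠ 0} := by
    simp only [div_eq_mul_inv]
    exact (differentiable_ev P).differentiableOn.mul (hd.differentiableOn.inv fun z hz => hz)
  exact hq.smul (differentiableOn_cross hg.differentiableOn (differentiableOn_const w))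

theorem isOpen_dotProduct_ne_zero {f : V × V → V} (hf : Continuous f) (w : V) :
    IsOpen {z | w ⬝ᵥ f z ≠ 0} :=
  isOpen_ne_fun (continuous_const.dotProduct hf) continuous_const

/-- A section of `D ⊗ O_M(a, b)` with polynomial coordinates is holomorphic. -/
theorem isHolomorphic_of_sectionCoord {s : ∀ m : M, contact m ⊗[ℂ] OM a b m} {P Q : BiPoly}
    (h : ∀ y, sectionCoord s y = (ev y.val P, ev y.val Q)) : IsHolomorphic s := by
  intro m₀ c₀
  -- the auxiliary vectors are fixed as the conjugates of the coordinates `c₀`, so that the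
  -- representatives are holomorphic functions of `z`
  refine ⟨{z | star c₀.1.1 ⬝ᵥ z.1 ≠ 0} ∩ {z | star c₀.1.2 ⬝ᵥ z.2 ≠ 0},
    fun z => (ev z P / (star c₀.1.1 ⬝ᵥ z.1)) • (z.2 ⨯₃ star c₀.1.1),
    fun z => (ev z Q / (star c₀.1.2 ⬝ᵥ z.2)) • (z.1 ⨯₃ star c₀.1.2),
    (isOpen_dotProduct_ne_zero continuous_fst _).inter
      (isOpen_dotProduct_ne_zero continuous_snd _),
    ⟨star_dotProduct_self_ne_zero c₀.2.1.1, star_dotProduct_self_ne_zero c₀.2.2.1⟩,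
    (differentiableOn_smul_cross P differentiable_fst differentiable_snd _).mono
      Set.inter_subset_left,
    (differentiableOn_smul_cross Q differentiable_snd differentiable_fst _).mono
      Set.inter_subset_right, fun m c hc => ?_⟩
  have hy := h ⟨m, c⟩
  rw [sectionCoord] at hy
  rw [represents_iff (Subtype.prop _), hy]
  exact ⟨cross_smul_cross c.incident hc.1 _,
    cross_smul_cross (by rw [dotProduct_comm, c.incident]) hc.2 _⟩

/-- Every pair of bihomogeneous polynomials of the bidegrees `(a + 2, b - 1)` and `(a - 1, b + 2)`
gives the coordinates of a section. -/
theorem exists_section {p q p' q' : ℕ} (hp : (p : ℤ) = a + 2) (hq : (q : ℤ) = b - 1)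
    (hp' : (p' : ℤ) = a - 1) (hq' : (q' : ℤ) = b + 2) {P Q : BiPoly} (hP : P ∈ biHom p q)
    (hQ : Q ∈ biHom p' q') :
    ∃ s : ∀ m : M, contact m ⊗[ℂ] OM a b m,
      ∀ y, sectionCoord s y = (ev y.val P, ev y.val Q) := by
  have hex : ∀ m : M, ∃ τ : contact m ⊗[ℂ] OM a b m,
      contactCoord (someCoord m) (valueAt a b (someCoord m) τ).1 =
        (ev (someCoord m).1 P, ev (someCoord m).1 Q) := by
    intro m
    obtain ⟨v, hv, hvc⟩ := exists_contactCoord_eq (someCoord m) (ev (someCoord m).1 P)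
      (ev (someCoord m).1 Q)
    obtain ⟨τ, hτ⟩ := (valueAt_bijective a b (someCoord m)).2 ⟨v, hv⟩
    exact ⟨τ, by rw [hτ, hvc]⟩
  choose s hs using hex
  refine ⟨s, fun ⟨m, c⟩ => ?_⟩
  obtain ⟨σ, τ, hσ, hτ, h⟩ := (someCoord m).exists_smul c
  have h0 : sectionCoord s ⟨m, someCoord m⟩ = _ := hs m
  rw [sectionCoord_smul s hσ hτ h, h0, ← hp, ← hq, ← hp', ← hq', CoordPoint.val, h,
    ev_smul hP, ev_smul hQ]
  simp only [zpow_natCast]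

/-! ### The dimension of the space of differential equations -/

/-- The two coordinates of the global sections of `D ⊗ O_M(a, b)`. -/
def H0Coord (a b : ℤ) : H0 a b →ₗ[ℂ] (CoordPoint → ℂ) × (CoordPoint → ℂ) where
  toFun s := (fun y => (sectionCoord s.1 y).1, fun y => (sectionCoord s.1 y).2)
  map_add' s s' := by ext <;> simp [sectionCoord]
  map_smul' k s := by ext <;> simp [sectionCoord]

theorem H0Coord_injective (a b : ℤ) : Function.Injective (H0Coord a b) := fun _ _ h =>
  Subtype.ext (sectionCoord_injective (funext fun y =>
    Prod.ext (congrFun (congrArg Prod.fst h) y) (congrFun (congrArg Prod.snd h) y)))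

theorem range_H0Coord {p q p' q' : ℕ} (hp : (p : ℤ) = a + 2) (hq : (q : ℤ) = b - 1)
    (hp' : (p' : ℤ) = a - 1) (hq' : (q' : ℤ) = b + 2) :
    LinearMap.range (H0Coord a b) =
      (biHomOn CoordPoint.val p q).prod (biHomOn CoordPoint.val p' q') := by
  refine le_antisymm ?_ ?_
  · rintro _ ⟨s, rfl⟩
    exact ⟨sectionCoord_fst_mem s.2 hp hq, sectionCoord_snd_mem s.2 hp' hq'⟩
  · rintro ⟨_, _⟩ ⟨⟨P, hP, rfl⟩, Q, hQ, rfl⟩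
    obtain ⟨s, hs⟩ := exists_section hp hq hp' hq' hP hQ
    refine ⟨⟨s, isHolomorphic_of_sectionCoord hs⟩, Prod.ext (funext fun y => ?_)
      (funext fun y => ?_)⟩
    · exact congrArg Prod.fst (hs y)
    · exact congrArg Prod.snd (hs y)

/-- `H⁰(M, D ⊗ O_M(a, b)) = H⁰(M, O_M(a + 2, b - 1)) ⊕ H⁰(M, O_M(a - 1, b + 2))`. -/
def H0Equiv {p q p' q' : ℕ} (hp : (p : ℤ) = a + 2) (hq : (q : ℤ) = b - 1)
    (hp' : (p' : ℤ) = a - 1) (hq' : (q' : ℤ) = b + 2) :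
    H0 a b ≃ₗ[ℂ] biHomOn CoordPoint.val p q × biHomOn CoordPoint.val p' q' :=
  LinearEquiv.ofInjective _ (H0Coord_injective a b) ≪≫ₗ
    LinearEquiv.ofEq _ _ (range_H0Coord hp hq hp' hq') ≪≫ₗ
      { toFun x := (⟨x.1.1, x.2.1⟩, ⟨x.1.2, x.2.2⟩)
        invFun x := ⟨(x.1.1, x.2.1), x.1.2, x.2.2⟩
        map_add' _ _ := rfl
        map_smul' _ _ := rfl }

end SecondOrderODE

end

theorem mainTheorem6 (a b : ℤ) (ha : 1 ≤ a) (hb : 1 ≤ b) :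
    FiniteDimensional ℂ (SecondOrderODE.H0 a b) ∧
      (SecondOrderODE.dimE a b : ℚ) =
        1 / 2 * (2 * a ^ 2 * b + 2 * a * b ^ 2 + 3 * a ^ 2 + 3 * b ^ 2 + 12 * a * b
          + 9 * a + 9 * b) - 1 := by
  obtain ⟨n, rfl⟩ : ∃ n : ℕ, a = n + 1 := ⟨(a - 1).toNat, by omega⟩
  obtain ⟨k, rfl⟩ : ∃ k : ℕ, b = k + 1 := ⟨(b - 1).toNat, by omega⟩
  let e := SecondOrderODE.H0Equiv (a := n + 1) (b := k + 1) (p := n + 3) (q := k) (p' := n)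
    (q' := k + 3) (by push_cast; ring) (by ring) (by ring) (by push_cast; ring)
  refine ⟨Module.Finite.equiv e.symm, ?_⟩
  have h₁ := SecondOrderODE.two_mul_finrank_biHomOn SecondOrderODE.CoordPoint.range_val (n + 3) k
  have h₂ := SecondOrderODE.two_mul_finrank_biHomOn SecondOrderODE.CoordPoint.range_val n (k + 3)
  rw [SecondOrderODE.dimE, SecondOrderODE.projectiveDim, e.finrank_eq, Module.finrank_prod]
  have h₁' := congrArg (Nat.cast : ℕ → ℚ) h₁
  have h₂' := congrArg (Nat.cast : ℕ → ℚ) h₂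
  push_cast at h₁' h₂' ⊢
  linear_combination (h₁' + h₂') / 2
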